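/- Theorem (Characterisation of cofibrations). Let $\mathcal{E}$ be a countably lextensive category, i.e. a category with finite limits and countable coproducts in which countable coproducts are van Kampen colimits, and let $s\mathcal{E} = [\Delta^{\mathrm{op}}, \mathcal{E}]$ be the category of simplicial objects in $\mathcal{E}$. A map $A \to B$ in $\mathcal{E}$ is a complemented inclusion if there is a map $C \to B$ such that the two maps exhibit $B$ as a coproduct of $A$ and $C$. For $T \in \mathcal{E}$ and $X \in s\mathcal{E}$ let $T \times X$ be the simplicial object with $(T \times X)_n = T \times X_n$, and for $X, Y \in s\mathcal{E}$ let $\mathrm{Hom}(X, Y)$ be the presheaf $T \mapsto s\mathcal{E}(T \times X, Y)$ on $\mathcal{E}$. A map $i \colon A \to B$ in $s\mathcal{E}$ has the enriched left lifting property with respect to $p \colon X \to Y$ (and $p$ has the enriched right lifting property with respect to $i$) if the map $$\mathrm{Hom}(B, X) \to \mathrm{Hom}(A, X) \times_{\mathrm{Hom}(A, Y)} \mathrm{Hom}(B, Y)$$ is a split epimorphism of presheaves on $\mathcal{E}$. For a levelwise countable simplicial set $K$ let $\underline{K} \in s\mathcal{E}$ be given by $\underline{K}_n = \coprod_{K_n}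 1$. A map in $s\mathcal{E}$ is a cofibration if it has the enriched left lifting property with respect to every map that has the enriched right lifting property with respect to all the maps $\underline{\partial\Delta[n]} \to \underline{\Delta[n]}$, $n \geq 0$. Let $i \colon A \to B$ be a map in $s\mathcal{E}$. Then the following are equivalent: (i) the map $i$ is a cofibration; (ii) every component $A_n \to B_n$ is a complemented inclusion in $\mathcal{E}$, and for every degeneracy operator $[m] \to [n]$ (surjective monotone map) the pushout $A_m \sqcup_{A_n} B_n$ exists and the induced map $A_m \sqcup_{A_n} B_n \to B_m$ is a complemented inclusion in $\mathcal{E}$. -/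

import Mathlib

open CategoryTheory CategoryTheory.Limits Opposite Simplicial

universe v u

noncomputable section

namespace EffectiveModel

/-- A category is countably lextensive if it has finite limits and countable coproducts, and
countable coproducts are van Kampen colimits. -/
class CountablyLextensive (E : Type u) [Category.{v} E] : Prop where
  [hasFiniteLimits : HasFiniteLimits E]
  [hasCountableCoproducts : HasCountableCoproducts E]
  isVanKampen : ∀ (J : Type) [Countable J] (F : Discrete J ⥤ E) (c : Cocone F),
    IsColimit c → IsVanKampenColimit c

attribute [instance] CountablyLextensive.hasFiniteLimits
attribute [instance] CountablyLextensive.hasCountableCoproducts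

section

variable {E : Type u} [Category.{v} E]

/-- A map `i : A ⟶ B` is a complemented inclusion if there is a map `j : C ⟶ B` such that
`i` and `j` exhibit `B` as a coproduct of `A` and `C`. -/
def IsComplementedInclusion {A B : E} (i : A ⟶ B) : Prop :=
  ∃ (C : E) (j : C ⟶ B), Nonempty (IsColimit (BinaryCofan.mk i j))

/-- A map of simplicial objects all of whose components are complemented inclusions. -/
def IsLevelwiseComplementedInclusion {A B : SimplicialObject E} (i : A ⟶ B) : Prop :=
  ∀ n : SimplexCategory, IsComplementedInclusion (i.app (op n))

end

section Enrichment

variable {E : Type u} [Category.{v} E] [HasFiniteLimits E]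

/-- The simplicial object `T × X` with `(T × X)_n = T × X_n`. -/
abbrev tensor (T : E) (X : SimplicialObject E) : SimplicialObject E :=
  X ⋙ prod.functor.obj T

/-- The map `T × f : T × X ⟶ T × Y`. -/
abbrev tensorMapRight (T : E) {X Y : SimplicialObject E} (f : X ⟶ Y) : tensor T X ⟶ tensor T Y :=
  Functor.whiskerRight f (prod.functor.obj T)

/-- The map `t × X : S × X ⟶ T × X`. -/
abbrev tensorMapLeft {S T : E} (t : S ⟶ T) (X : SimplicialObject E) : tensor S X ⟶ tensor T X :=
  Functor.whiskerLeft X (prod.functor.map t)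

/-- The hom-presheaf `T ↦ Hom(T × X, Y)` on `E`. -/
def homPsh (X Y : SimplicialObject E) : Eᵒᵖ ⥤ Type v where
  obj T := tensor T.unop X ⟶ Y
  map t := ↾fun u ↦ tensorMapLeft t.unop X ≫ u
  map_id T := by
    ext u
    simp
  map_comp s t := by
    ext u
    simp [← Category.assoc]

lemma tensorMapLeft_comp_tensorMapRight {S T : E} (t : S ⟶ T) {A B : SimplicialObject E}
    (i : A ⟶ B) : tensorMapLeft t A ≫ tensorMapRight T i =
      tensorMapRight S i ≫ tensorMapLeft t B := by
  ext n
  exact (prod.functor.map t).naturality (i.app n) |>.symm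

/-- The presheaf of lifting problems of `i` against `p`, that is, the pullback
`Hom(A, X) ×_{Hom(A, Y)} Hom(B, Y)`. Its value at `T` is the set of commutative squares
from `T × i` to `p`. -/
def probPsh {A B X Y : SimplicialObject E} (i : A ⟶ B) (p : X ⟶ Y) : Eᵒᵖ ⥤ Type v where
  obj T := { w : (tensor T.unop A ⟶ X) × (tensor T.unop B ⟶ Y) //
    w.1 ≫ p = tensorMapRight T.unop i ≫ w.2 }
  map {S T} t := ↾fun w ↦
    ⟨(tensorMapLeft t.unop A ≫ w.1.1, tensorMapLeft t.unop B ≫ w.1.2), by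
      rw [Category.assoc, w.2, ← Category.assoc, tensorMapLeft_comp_tensorMapRight,
        Category.assoc]⟩
  map_id T := by
    ext w <;> simp
  map_comp s t := by
    ext w <;> simp [← Category.assoc]

/-- The pullback hom `Hom(B, X) ⟶ Hom(A, X) ×_{Hom(A, Y)} Hom(B, Y)` of presheaves on `E`. -/
def pullbackHom {A B X Y : SimplicialObject E} (i : A ⟶ B) (p : X ⟶ Y) :
    homPsh B X ⟶ probPsh i p where
  app T := ↾fun d : tensor T.unop B ⟶ X ↦
    ⟨(tensorMapRight T.unop i ≫ d, d ≫ p), Category.assoc _ _ _⟩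
  naturality S T t := by
    ext (d : tensor S.unop B ⟶ X)
    apply Subtype.ext
    refine Prod.ext ?_ (Category.assoc _ _ _)
    exact (Category.assoc _ _ _).symm.trans
      ((congrArg (· ≫ d) (tensorMapLeft_comp_tensorMapRight t.unop i).symm).trans
        (Category.assoc _ _ _))

/-- The enriched lifting property of `i` on the left against `p` on the right: the pullback hom
is a split epimorphism of presheaves. -/
def HasEnrichedLiftingProperty {A B X Y : SimplicialObject E} (i : A ⟶ B) (p : X ⟶ Y) : Prop :=
  IsSplitEpi (pullbackHom i p)

/-- Enriched `I`-fibrations: the maps with the enriched right lifting property against `I`. -/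
def IsEnrichedFibration (I : MorphismProperty (SimplicialObject E))
    {X Y : SimplicialObject E} (p : X ⟶ Y) : Prop :=
  ∀ ⦃A B : SimplicialObject E⦄ (i : A ⟶ B), I i → HasEnrichedLiftingProperty i p

/-- Enriched `I`-cofibrations: the maps with the enriched left lifting property against
all enriched `I`-fibrations. -/
def IsEnrichedCofibration (I : MorphismProperty (SimplicialObject E))
    {A B : SimplicialObject E} (i : A ⟶ B) : Prop :=
  ∀ ⦃X Y : SimplicialObject E⦄ (p : X ⟶ Y), IsEnrichedFibration I p →
    HasEnrichedLiftingProperty i p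

end Enrichment

section Generators

variable (E : Type u) [Category.{v} E] [CountablyLextensive E]

/-- The simplicial object associated with a levelwise countable simplicial set `K`: in degree `n`
it is the coproduct of copies of the terminal object indexed by `K_n`. -/
def discreteObj (K : SSet.{0}) [∀ n, Countable (K.obj n)] : SimplicialObject E where
  obj n := ∐ fun _ : K.obj n ↦ ⊤_ E
  map f := Sigma.map' (K.map f) fun _ ↦ 𝟙 _
  map_id n := by
    ext x
    simp
  map_comp f g := by
    ext x
    simp

/-- The action of `discreteObj` on maps of simplicial sets. -/
def discreteMap {K L : SSet.{0}} [∀ n, Countable (K.obj n)] [∀ n, Countable (L.obj n)]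
    (f : K ⟶ L) : discreteObj E K ⟶ discreteObj E L where
  app n := Sigma.map' (f.app n) fun _ ↦ 𝟙 _
  naturality m n g := by
    dsimp [discreteObj]
    ext x
    simp

/-- The images in simplicial objects of the boundary inclusions `∂Δ[n] ⟶ Δ[n]`, `n ≥ 0`. -/
def boundaryInclusions : MorphismProperty (SimplicialObject E) :=
  MorphismProperty.ofHoms fun n : ℕ ↦ discreteMap E (SSet.boundary.{0} n).ι

end Generators

section Cofibrations

variable {E : Type u} [Category.{v} E] [CountablyLextensive E]

/-- A cofibration of simplicial objects is an enriched cofibration with respect to the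
boundary inclusions. -/
def IsCofibration {A B : SimplicialObject E} (i : A ⟶ B) : Prop :=
  IsEnrichedCofibration (boundaryInclusions E) i

end Cofibrations

section Degeneracies

variable {E : Type u} [Category.{v} E]

/-- For `s : [m] ⟶ [n]`, the pushout `A_m ⊔_{A_n} B_n` exists and the induced map
`A_m ⊔_{A_n} B_n ⟶ B_m` is a complemented inclusion. -/
def IsRelativelyComplementedAt {A B : SimplicialObject E} (i : A ⟶ B)
    {m n : SimplexCategory} (s : m ⟶ n) : Prop :=
  ∃ _ : HasPushout (A.map s.op) (i.app (op n)),
    IsComplementedInclusion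
      (pushout.desc (i.app (op m)) (B.map s.op) (i.naturality s.op) :
        pushout (A.map s.op) (i.app (op n)) ⟶ B.obj (op m))

end Degeneracies

end EffectiveModel

end

/-! Sufficiency. The enriched right lifting property against the boundary inclusions amounts to
boundary fillers natural in a parameter object (`isEnrichedFibration_boundaryInclusions_iff`). With
P the presheaf of lifting problems of i against such a p, a lift is a compatible sequence of maps P
× Hom(-, B_n) ⟶ Hom(-, X_n) (`NatFamily`), built by recursion on n. In degree n, fillers give a
family over Y with the right faces, but it ignores A and the degeneracies. It is therefore
overwritten on A_n and on the images under elementary degeneracies of the complement C of A_{n-1} in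
B_{n-1}. Condition (ii) makes these images complemented: C is the complement of A_n in A_n
⊔_{A_{n-1}} B_{n-1}. The images of B_{n-1} itself need not be complemented. Families may be
redefined freely on complemented subobjects as long as the prescribed values agree on overlaps
(`exists_glue`), and here agreement follows from the simplicial identities (`exists_extension`).

Necessity. For surjective s : m ⟶ n, maps B ⟶ `coind s f` correspond to squares from B_n ⟶ B_m to f.
If a map of arrows has split epimorphic components, even with sections not forming a map of arrows,
the coinduced map has natural fillers (`nonempty_filler_coind`). So for a cofibration, A_n ⟶ A_m to
B_n ⟶ B_m lifts against such maps of arrows (`IsCofibration.exists_lift`). Choosing P ⨿ Q ⟶ Q as a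
component, the lift exhibits e : P ⟶ Q as a pullback of the inclusion P ⟶ P ⨿ Q, so e is
complemented (`isComplementedInclusion_of_lift`). -/

noncomputable section

namespace EffectiveModel

/-! ### Complemented inclusions in extensive categories -/

section Complemented

variable {E : Type u} [Category.{v} E]

instance [CountablyLextensive E] : FinitaryExtensive E where
  hasFiniteCoproducts := ⟨fun _ ↦ inferInstance⟩
  van_kampen' c hc := CountablyLextensive.isVanKampen _ _ c hc

/-- The maps `u` and `v` exhibit their codomain as a coproduct. -/
structure IsCoprod {U V B : E} (u : U ⟶ B) (v : V ⟶ B) : Prop where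
  hom_ext {Y : E} {f g : B ⟶ Y} (hu : u ≫ f = u ≫ g) (hv : v ≫ f = v ≫ g) : f = g
  exists_desc {Y : E} (f : U ⟶ Y) (g : V ⟶ Y) : ∃ d : B ⟶ Y, u ≫ d = f ∧ v ≫ d = g

lemma IsCoprod.nonempty_isColimit {U V B : E} {u : U ⟶ B} {v : V ⟶ B} (h : IsCoprod u v) :
    Nonempty (IsColimit (BinaryCofan.mk u v)) := by
  choose d hu hv using @h.exists_desc
  exact ⟨BinaryCofan.IsColimit.mk _ (fun f g ↦ d f g) (fun f g ↦ hu f g) (fun f g ↦ hv f g)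
    fun f g m h₁ h₂ ↦ h.hom_ext (h₁.trans (hu f g).symm) (h₂.trans (hv f g).symm)⟩

lemma IsCoprod.of_isColimit {U V B : E} {u : U ⟶ B} {v : V ⟶ B}
    (h : IsColimit (BinaryCofan.mk u v)) : IsCoprod u v where
  hom_ext hu hv := BinaryCofan.IsColimit.hom_ext h hu hv
  exists_desc f g :=
    ⟨h.desc (BinaryCofan.mk f g), h.fac (BinaryCofan.mk f g) ⟨.left⟩,
      h.fac (BinaryCofan.mk f g) ⟨.right⟩⟩

lemma isComplementedInclusion_iff {A B : E} {i : A ⟶ B} :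
    IsComplementedInclusion i ↔ ∃ (C : E) (j : C ⟶ B), IsCoprod i j :=
  ⟨fun ⟨C, j, ⟨h⟩⟩ ↦ ⟨C, j, .of_isColimit h⟩, fun ⟨C, j, h⟩ ↦ ⟨C, j, h.nonempty_isColimit⟩⟩

lemma IsCoprod.symm {U V B : E} {u : U ⟶ B} {v : V ⟶ B} (h : IsCoprod u v) : IsCoprod v u where
  hom_ext hv hu := h.hom_ext hu hv
  exists_desc f g :=
    let ⟨d, h₁, h₂⟩ := h.exists_desc g f
    ⟨d, h₂, h₁⟩

/-- Binary coproducts in an extensive category are stable under pullback. -/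
lemma IsCoprod.of_isPullback [FinitaryExtensive E] {U V B Z U' V' : E}
    {u : U ⟶ B} {v : V ⟶ B} (h : IsCoprod u v) {b : Z ⟶ B} {u' : U' ⟶ Z} {v' : V' ⟶ Z}
    {r : U' ⟶ U} {s : V' ⟶ V} (hu : IsPullback u' r b u) (hv : IsPullback v' s b v) :
    IsCoprod u' v' :=
  .of_isColimit (((BinaryCofan.isVanKampen_iff _).1
    (FinitaryExtensive.vanKampen _ h.nonempty_isColimit.some)
    (BinaryCofan.mk u' v') r s b hu.w.symm hv.w.symm).2 ⟨hu, hv⟩).some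

lemma IsCoprod.pullback [FinitaryExtensive E] [HasPullbacks E] {U V B Z : E}
    {u : U ⟶ B} {v : V ⟶ B} (h : IsCoprod u v) (b : Z ⟶ B) :
    IsCoprod (pullback.fst b u) (pullback.fst b v) :=
  h.of_isPullback (.of_hasPullback _ _) (.of_hasPullback _ _)

lemma IsComplementedInclusion.mono [FinitaryExtensive E] {A B : E} {i : A ⟶ B}
    (hi : IsComplementedInclusion i) : Mono i := by
  obtain ⟨C, j, ⟨hc⟩⟩ := hi
  exact FinitaryExtensive.mono_inl_of_isColimit hc

lemma IsComplementedInclusion.comp [HasFiniteCoproducts E] {A B D : E} {i : A ⟶ B} {j : B ⟶ D}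
    (hi : IsComplementedInclusion i) (hj : IsComplementedInclusion j) :
    IsComplementedInclusion (i ≫ j) := by
  rw [isComplementedInclusion_iff] at *
  obtain ⟨C, k, h⟩ := hi
  obtain ⟨C', k', h'⟩ := hj
  refine ⟨C ⨿ C', coprod.desc (k ≫ j) k', ⟨fun {Y f g} hu hv ↦ ?_, fun {Y} f g ↦ ?_⟩⟩
  · have h₁ := coprod.inl ≫= hv
    have h₂ := coprod.inr ≫= hv
    simp only [coprod.inl_desc_assoc, coprod.inr_desc_assoc, Category.assoc] at h₁ h₂ hu
    exact h'.hom_ext (h.hom_ext hu h₁) h₂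
  · obtain ⟨d, h₁, h₂⟩ := h.exists_desc f (coprod.inl ≫ g)
    obtain ⟨d', h₁', h₃⟩ := h'.exists_desc d (coprod.inr ≫ g)
    exact ⟨d', by rw [Category.assoc, h₁', h₁], by
      ext
      · rw [coprod.inl_desc_assoc, Category.assoc, h₁', h₂]
      · rw [coprod.inr_desc_assoc, h₃]⟩

/-- If `e : P ⟶ Q` lifts against the split epimorphism `P ⨿ Q ⟶ Q`, then it is a
complemented inclusion. -/
lemma isComplementedInclusion_of_lift [FinitaryExtensive E] [HasPullbacks E] {P Q : E} (e : P ⟶ Q)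
    (d : Q ⟶ P ⨿ Q) (hed : e ≫ d = coprod.inl) (hd : d ≫ coprod.desc e (𝟙 Q) = 𝟙 Q) :
    IsComplementedInclusion e := by
  -- If d z = inl x, applying the retraction [e, 1] gives z = e x, so the preimage of the summand P
  -- under d is exactly e.
  have sq : IsPullback e (𝟙 P) d coprod.inl := by
    refine ⟨⟨by simp [hed]⟩, ⟨PullbackCone.IsLimit.mk _ (fun s ↦ s.snd) (fun s ↦ ?_)
      (fun s ↦ Category.comp_id _) (fun s m _ hm ↦ (Category.comp_id m).symm.trans hm)⟩⟩
    have := s.condition =≫ coprod.desc e (𝟙 Q)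
    rw [Category.assoc, Category.assoc, hd, coprod.inl_desc, Category.comp_id] at this
    exact this.symm
  exact isComplementedInclusion_iff.2 ⟨_, pullback.fst d coprod.inr,
    (IsCoprod.of_isColimit (coprodIsCoprod P Q)).of_isPullback sq (.of_hasPullback _ _)⟩

/-- The pushout of a coproduct inclusion is a coproduct inclusion with the same complement. -/
lemma IsCoprod.of_isPushout {A B C A' P : E} {i : A ⟶ B} {j : C ⟶ B} {f : A ⟶ A'}
    {inl : A' ⟶ P} {inr : B ⟶ P} (h : IsCoprod i j)
    (sq : IsPushout f i inl inr) : IsCoprod inl (j ≫ inr) where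
  hom_ext {Y g g'} hu hv := by
    refine sq.hom_ext hu (h.hom_ext ?_ (by simpa using hv))
    rw [← sq.w_assoc, ← sq.w_assoc, hu]
  exists_desc {Y} g g' := by
    obtain ⟨d, h₁, h₂⟩ := h.exists_desc (f ≫ g) g'
    exact ⟨sq.desc g d h₁.symm, by simp, by simp [h₂]⟩

/-- Complemented inclusions have pushouts along arbitrary maps. -/
lemma IsComplementedInclusion.hasPushout [HasFiniteCoproducts E] {A B A' : E} {i : A ⟶ B}
    (hi : IsComplementedInclusion i) (f : A ⟶ A') : HasPushout f i := by
  obtain ⟨C, j, h⟩ := isComplementedInclusion_iff.1 hi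
  obtain ⟨d, hl, hr⟩ := h.exists_desc (f ≫ coprod.inl) (coprod.inr : C ⟶ A' ⨿ C)
  refine IsPushout.hasPushout (inl := coprod.inl) (inr := d)
    ⟨⟨hl.symm⟩, ⟨PushoutCocone.IsColimit.mk _ (fun s ↦ coprod.desc s.inl (j ≫ s.inr))
      (fun s ↦ coprod.inl_desc _ _) (fun s ↦ h.hom_ext ?_ ?_) (fun s m h₁ h₂ ↦ ?_)⟩⟩
  · rw [reassoc_of% hl, coprod.inl_desc, s.condition]
  · rw [reassoc_of% hr, coprod.inr_desc]
  · ext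
    · rw [coprod.inl_desc, h₁]
    · rw [coprod.inr_desc, ← h₂, reassoc_of% hr]

end Complemented

/-! ### Natural families of generalized elements and their gluing -/

section Families

variable {E : Type u} [Category.{v} E]

/-- A map of presheaves `P × Hom(-, B) ⟶ Hom(-, X)` on `E`. -/
structure NatFamily (P : Eᵒᵖ ⥤ Type v) (B X : E) where
  /-- the value on a pair of generalized elements -/
  app {Z : E} (w : P.obj (op Z)) (b : Z ⟶ B) : Z ⟶ X
  naturality {Z' Z : E} (t : Z' ⟶ Z) (w : P.obj (op Z)) (b : Z ⟶ B) :
    app (P.map t.op w) (t ≫ b) = t ≫ app w b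

namespace NatFamily

variable {P : Eᵒᵖ ⥤ Type v} {B X : E}

/-- Restriction of a family along a map into `B`. -/
def precomp (F : NatFamily P B X) {R : E} (r : R ⟶ B) : NatFamily P R X where
  app w b := F.app w (b ≫ r)
  naturality t w b := by rw [Category.assoc, F.naturality]

/-- Composition of a family with a map out of `X`. -/
def postcomp (F : NatFamily P B X) {X' : E} (f : X ⟶ X') : NatFamily P B X' where
  app w b := F.app w b ≫ f
  naturality t w b := by rw [F.naturality, Category.assoc]

variable [FinitaryExtensive E] [HasPullbacks E]

/-- The preimages of U and V under b exhibit Z as a coproduct, and naturality reduces the value at b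
to its restrictions to these preimages. -/
lemma app_eq_of_isCoprod {U V : E} {u : U ⟶ B} {v : V ⟶ B}
    (hc : IsCoprod u v) (F G : NatFamily P B X)
    (hu : ∀ ⦃Z : E⦄ (w : P.obj (op Z)) (x : Z ⟶ U), F.app w (x ≫ u) = G.app w (x ≫ u))
    (hv : ∀ ⦃Z : E⦄ (w : P.obj (op Z)) (x : Z ⟶ V), F.app w (x ≫ v) = G.app w (x ≫ v))
    {Z : E} (w : P.obj (op Z)) (b : Z ⟶ B) : F.app w b = G.app w b := by
  apply (hc.pullback b).hom_ext
  · rw [← F.naturality, ← G.naturality, pullback.condition, hu]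
  · rw [← F.naturality, ← G.naturality, pullback.condition, hv]

/-- Families can be defined separately on the two summands of a coproduct. -/
lemma exists_app_of_isCoprod {U V : E} {u : U ⟶ B} {v : V ⟶ B}
    (hc : IsCoprod u v) (F : NatFamily P U X) (G : NatFamily P V X) :
    ∃ H : NatFamily P B X,
      (∀ ⦃Z : E⦄ (w : P.obj (op Z)) (x : Z ⟶ U), H.app w (x ≫ u) = F.app w x) ∧
      (∀ ⦃Z : E⦄ (w : P.obj (op Z)) (x : Z ⟶ V), H.app w (x ≫ v) = G.app w x) := by
  -- The value at b is glued over the preimages of U and V. Testing against every t landing in a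
  -- summand, not only the pullback projections, lets naturality follow from uniqueness.
  have key {Z : E} (w : P.obj (op Z)) (b : Z ⟶ B) : ∃ d : Z ⟶ X,
      (∀ ⦃Z' : E⦄ (t : Z' ⟶ Z) (x : Z' ⟶ U), t ≫ b = x ≫ u →
        t ≫ d = F.app (P.map t.op w) x) ∧
      (∀ ⦃Z' : E⦄ (t : Z' ⟶ Z) (x : Z' ⟶ V), t ≫ b = x ≫ v →
        t ≫ d = G.app (P.map t.op w) x) := by
    obtain ⟨d, hl, hr⟩ := (hc.pullback b).exists_desc
      (F.app (P.map (pullback.fst b u).op w) (pullback.snd b u))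
      (G.app (P.map (pullback.fst b v).op w) (pullback.snd b v))
    refine ⟨d, fun Z' t x hx ↦ ?_, fun Z' t x hx ↦ ?_⟩
    · have := pullback.lift t x hx ≫= hl
      rw [pullback.lift_fst_assoc, ← F.naturality, pullback.lift_snd] at this
      rw [this, ← ConcreteCategory.comp_apply, ← P.map_comp, ← op_comp, pullback.lift_fst]
    · have := pullback.lift t x hx ≫= hr
      rw [pullback.lift_fst_assoc, ← G.naturality, pullback.lift_snd] at this
      rw [this, ← ConcreteCategory.comp_apply, ← P.map_comp, ← op_comp, pullback.lift_fst]
  choose d hdu hdv using @key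
  refine ⟨⟨fun w b ↦ d w b, fun {Z' Z} t w b ↦ ?_⟩, fun Z w x ↦ ?_, fun Z w x ↦ ?_⟩
  · apply (hc.pullback (t ≫ b)).hom_ext
    · rw [hdu _ _ _ _ pullback.condition, ← Category.assoc,
        hdu w b (pullback.fst (t ≫ b) u ≫ t) (pullback.snd (t ≫ b) u)
          (by rw [Category.assoc, pullback.condition])]
      simp
    · rw [hdv _ _ _ _ pullback.condition, ← Category.assoc,
        hdv w b (pullback.fst (t ≫ b) v ≫ t) (pullback.snd (t ≫ b) v)
          (by rw [Category.assoc, pullback.condition])]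
      simp
  · have := hdu w (x ≫ u) (𝟙 Z) x (by simp)
    simpa using this
  · have := hdv w (x ≫ v) (𝟙 Z) x (by simp)
    simpa using this

/-- A family can be modified on a complemented subobject. -/
lemma exists_override (G : NatFamily P B X) {U : E} {u : U ⟶ B} (hu : IsComplementedInclusion u)
    (F : NatFamily P U X) :
    ∃ H : NatFamily P B X,
      (∀ ⦃Z : E⦄ (w : P.obj (op Z)) (x : Z ⟶ U), H.app w (x ≫ u) = F.app w x) ∧
      ∀ ⦃R X' : E⦄ (r : R ⟶ B) (f : X ⟶ X') (K : NatFamily P R X'),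
        (∀ ⦃Z : E⦄ (w : P.obj (op Z)) (y : Z ⟶ R), G.app w (y ≫ r) ≫ f = K.app w y) →
        (∀ ⦃Z : E⦄ (w : P.obj (op Z)) (y : Z ⟶ R) (x : Z ⟶ U), y ≫ r = x ≫ u →
          F.app w x ≫ f = K.app w y) →
        ∀ ⦃Z : E⦄ (w : P.obj (op Z)) (y : Z ⟶ R), H.app w (y ≫ r) ≫ f = K.app w y := by
  obtain ⟨V, v, hc⟩ := isComplementedInclusion_iff.1 hu
  -- G survives on the complement V. A constraint along r holds for the new family because R splits
  -- into the preimages of U and V: the overlap with U is the condition on F, the rest is inherited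
  -- from G.
  obtain ⟨H, hHu, hHv⟩ := exists_app_of_isCoprod hc F (G.precomp v)
  refine ⟨H, hHu, fun R X' r f K hG hF Z w y ↦ ?_⟩
  refine app_eq_of_isCoprod (hc.pullback r) ((H.precomp r).postcomp f) K (fun Z w x ↦ ?_)
    (fun Z w x ↦ ?_) w y
  · change H.app w ((x ≫ _) ≫ r) ≫ f = _
    rw [Category.assoc, pullback.condition, ← Category.assoc, hHu]
    exact hF _ _ _ (by simp [pullback.condition])
  · change H.app w ((x ≫ _) ≫ r) ≫ f = _
    rw [Category.assoc, pullback.condition, ← Category.assoc, hHv, ← hG]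
    simp [pullback.condition, precomp]

/-- A family can be modified on finitely many complemented subobjects, by families that agree
on their overlaps. -/
lemma exists_glue {ι : Type*} (J : Finset ι) (G : NatFamily P B X) (U : ι → E)
    (u : ∀ j, U j ⟶ B) (hu : ∀ j, IsComplementedInclusion (u j)) (F : ∀ j, NatFamily P (U j) X)
    (hF : ∀ (j k : ι) ⦃Z : E⦄ (w : P.obj (op Z)) (x : Z ⟶ U j) (y : Z ⟶ U k),
      x ≫ u j = y ≫ u k → (F j).app w x = (F k).app w y) :
    ∃ H : NatFamily P B X,
      (∀ j ∈ J, ∀ ⦃Z : E⦄ (w : P.obj (op Z)) (x : Z ⟶ U j), H.app w (x ≫ u j) = (F j).app w x) ∧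
      ∀ ⦃X' : E⦄ (f : X ⟶ X') (K : NatFamily P B X'),
        (∀ ⦃Z : E⦄ (w : P.obj (op Z)) (b : Z ⟶ B), G.app w b ≫ f = K.app w b) →
        (∀ j, ∀ ⦃Z : E⦄ (w : P.obj (op Z)) (x : Z ⟶ U j),
          (F j).app w x ≫ f = K.app w (x ≫ u j)) →
        ∀ ⦃Z : E⦄ (w : P.obj (op Z)) (b : Z ⟶ B), H.app w b ≫ f = K.app w b := by
  classical
  induction J using Finset.induction_on with
  | empty => exact ⟨G, by simp, fun X' f K h _ ↦ h⟩
  | insert k J _ ih =>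
    obtain ⟨H, hHJ, hH⟩ := ih
    obtain ⟨H', hH'k, hH'⟩ := H.exists_override (hu k) (F k)
    refine ⟨H', fun j hj Z w x ↦ ?_, fun X' f K hG hK Z w b ↦ ?_⟩
    · rcases Finset.mem_insert.1 hj with rfl | hj
      · exact hH'k w x
      -- Earlier values are kept by taking r = u j and f = 𝟙, where the overlap condition is
      -- agreement of the pieces; the constraint K below uses r = 𝟙.
      · simpa using hH' (u j) (𝟙 X) (F j) (fun Z w y ↦ by simpa using hHJ j hj w y)
          (fun Z w y x h ↦ by simpa using hF k j w x y h.symm) w x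
    · simpa using hH' (𝟙 B) f K (fun Z w y ↦ by simpa using hH f K hG hK w y)
        (fun Z w y x h ↦ by rw [hK]; simp [← h]) w b

end NatFamily

end Families

end EffectiveModel

end
noncomputable section

namespace EffectiveModel

/-! ### Maps out of T × K for a simplicial set K -/

section Discrete

variable {E : Type u} [Category.{v} E] [CountablyLextensive E]

/-- The inclusion of the summand of `T × ∐_J 1 ≅ ∐_J T` indexed by `j`. -/
def prodSigmaι (T : E) {J : Type} [Countable J] (j : J) : T ⟶ T ⨯ ∐ fun _ : J ↦ ⊤_ E :=
  prod.lift (𝟙 T) (terminal.from T ≫ Sigma.ι (fun _ : J ↦ ⊤_ E) j)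

lemma isPullback_prodSigmaι (T : E) {J : Type} [Countable J] (j : J) :
    IsPullback (prodSigmaι T j) (terminal.from T) prod.snd (Sigma.ι (fun _ : J ↦ ⊤_ E) j) := by
  refine ⟨⟨by rw [prodSigmaι, prod.lift_snd]⟩, ⟨PullbackCone.IsLimit.mk _ (fun s ↦ s.fst ≫ prod.fst)
    (fun s ↦ ?_) (fun s ↦ Subsingleton.elim _ _) (fun s m h _ ↦ ?_)⟩⟩
  · have h := s.condition
    apply Limits.prod.hom_ext
    · rw [Category.assoc, prodSigmaι, prod.lift_fst, Category.comp_id]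
    · rw [h, Category.assoc, Category.assoc, prodSigmaι, prod.lift_snd, ← Category.assoc,
        ← Category.assoc]
      congr 1
      exact Subsingleton.elim _ _
  · rw [← h, Category.assoc, prodSigmaι, prod.lift_fst, Category.comp_id]

/-- Pulling the coproduct of points back along the projection from T × ∐ 1 turns each summand into
T, and countable coproducts are universal. -/
lemma nonempty_isColimit_prodSigmaι (T : E) (J : Type) [Countable J] :
    Nonempty (IsColimit (Cofan.mk (T ⨯ ∐ fun _ : J ↦ ⊤_ E) (prodSigmaι T (J := J)))) :=
  (CountablyLextensive.isVanKampen J _ _ (coproductIsCoproduct fun _ : J ↦ ⊤_ E)).isUniversal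
    (Cofan.mk (T ⨯ ∐ fun _ : J ↦ ⊤_ E) (prodSigmaι T (J := J)))
    (Discrete.natTrans fun _ ↦ terminal.from T) prod.snd
    (by
      ext ⟨j⟩
      exact (isPullback_prodSigmaι T j).w.symm)
    (NatTrans.Equifibered.of_discrete _)
    (fun ⟨j⟩ ↦ isPullback_prodSigmaι T j)

lemma prodSigma_hom_ext {T Y : E} {J : Type} [Countable J] {f g : (T ⨯ ∐ fun _ : J ↦ ⊤_ E) ⟶ Y}
    (h : ∀ j, prodSigmaι T j ≫ f = prodSigmaι T j ≫ g) : f = g :=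
  Cofan.IsColimit.hom_ext (nonempty_isColimit_prodSigmaι T J).some _ _ h

lemma exists_prodSigma_desc {T Y : E} {J : Type} [Countable J] (φ : J → (T ⟶ Y)) :
    ∃ d : (T ⨯ ∐ fun _ : J ↦ ⊤_ E) ⟶ Y, ∀ j, prodSigmaι T j ≫ d = φ j :=
  ⟨Cofan.IsColimit.desc (nonempty_isColimit_prodSigmaι T J).some φ,
    Cofan.IsColimit.fac (nonempty_isColimit_prodSigmaι T J).some φ⟩

lemma prodSigmaι_map (T : E) {J J' : Type} [Countable J] [Countable J'] (k : J → J') (j : J) :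
    prodSigmaι T j ≫ prod.map (𝟙 T) (Sigma.map' k fun _ ↦ 𝟙 (⊤_ E)) = prodSigmaι T (k j) := by
  apply Limits.prod.hom_ext <;> simp [prodSigmaι]

lemma prodSigmaι_naturality {S T : E} (t : S ⟶ T) {J : Type} [Countable J] (j : J) :
    prodSigmaι S j ≫ prod.map t (𝟙 _) = t ≫ prodSigmaι T j := by
  apply Limits.prod.hom_ext
  · simp [prodSigmaι]
  · simp [prodSigmaι, ← Category.assoc]

variable {K L : SSet.{0}} [∀ n, Countable (K.obj n)] [∀ n, Countable (L.obj n)]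
  {T : E} {X Y : SimplicialObject E}

/-- The summand of `(T × K)_m` indexed by a simplex of `K`. -/
def simplexι (T : E) {m : SimplexCategoryᵒᵖ} (k : K.obj m) :
    T ⟶ (tensor T (discreteObj E K)).obj m :=
  prodSigmaι T k

lemma simplexι_map (T : E) {m m' : SimplexCategoryᵒᵖ} (α : m ⟶ m') (k : K.obj m) :
    simplexι T k ≫ (tensor T (discreteObj E K)).map α = simplexι T (K.map α k) :=
  prodSigmaι_map T (K.map α) k

lemma simplexι_tensorMapLeft {S T : E} (t : S ⟶ T) {m : SimplexCategoryᵒᵖ} (k : K.obj m) :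
    simplexι S k ≫ (tensorMapLeft t (discreteObj E K)).app m = t ≫ simplexι T k :=
  prodSigmaι_naturality t k

lemma simplexι_tensorMapRight (T : E) (g : K ⟶ L) {m : SimplexCategoryᵒᵖ} (k : K.obj m) :
    simplexι T k ≫ (tensorMapRight T (discreteMap E g)).app m = simplexι T (g.app m k) :=
  prodSigmaι_map T (g.app m) k

/-- The value at a simplex `k` of `K` of a map `T × K ⟶ X`. -/
def evalSimplex (f : tensor T (discreteObj E K) ⟶ X) {m : SimplexCategoryᵒᵖ} (k : K.obj m) :
    T ⟶ X.obj m :=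
  simplexι T k ≫ f.app m

lemma evalSimplex_ext {f g : tensor T (discreteObj E K) ⟶ X}
    (h : ∀ (m : SimplexCategoryᵒᵖ) (k : K.obj m), evalSimplex f k = evalSimplex g k) : f = g := by
  ext m
  exact prodSigma_hom_ext (h m)

lemma evalSimplex_map (f : tensor T (discreteObj E K) ⟶ X) {m m' : SimplexCategoryᵒᵖ}
    (α : m ⟶ m') (k : K.obj m) : evalSimplex f (K.map α k) = evalSimplex f k ≫ X.map α := by
  rw [evalSimplex, evalSimplex, ← simplexι_map, Category.assoc, Category.assoc, f.naturality α]

/-- With `evalSimplex_ext`, this replaces maps out of T × K by natural assignments of T-elements of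
X to simplices of K. -/
lemma exists_evalSimplex_eq (φ : ∀ m : SimplexCategoryᵒᵖ, K.obj m → (T ⟶ X.obj m))
    (hφ : ∀ ⦃m m' : SimplexCategoryᵒᵖ⦄ (α : m ⟶ m') (k : K.obj m),
      φ m' (K.map α k) = φ m k ≫ X.map α) :
    ∃ f : tensor T (discreteObj E K) ⟶ X, ∀ (m : SimplexCategoryᵒᵖ) (k : K.obj m),
      evalSimplex f k = φ m k := by
  have hd (m : SimplexCategoryᵒᵖ) : ∃ d : (tensor T (discreteObj E K)).obj m ⟶ X.obj m,
      ∀ k : K.obj m, simplexι T k ≫ d = φ m k := exists_prodSigma_desc (φ m)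
  choose d hd using hd
  refine ⟨⟨d, fun m m' α ↦ prodSigma_hom_ext fun k ↦ ?_⟩, hd⟩
  change simplexι T k ≫ _ ≫ _ = simplexι T k ≫ _
  rw [← Category.assoc, simplexι_map, hd, hφ, reassoc_of% (hd m k)]

lemma evalSimplex_comp (f : tensor T (discreteObj E K) ⟶ X) (p : X ⟶ Y) {m : SimplexCategoryᵒᵖ}
    (k : K.obj m) : evalSimplex (f ≫ p) k = evalSimplex f k ≫ p.app m :=
  (Category.assoc _ _ _).symm

lemma evalSimplex_tensorMapLeft {S : E} (t : S ⟶ T) (f : tensor T (discreteObj E K) ⟶ X)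
    {m : SimplexCategoryᵒᵖ} (k : K.obj m) :
    evalSimplex (tensorMapLeft t _ ≫ f) k = t ≫ evalSimplex f k :=
  (Category.assoc _ _ _).symm.trans
    ((congrArg (· ≫ f.app m) (simplexι_tensorMapLeft t k)).trans (Category.assoc _ _ _))

lemma evalSimplex_tensorMapRight (g : K ⟶ L) (f : tensor T (discreteObj E L) ⟶ X)
    {m : SimplexCategoryᵒᵖ} (k : K.obj m) :
    evalSimplex (tensorMapRight T (discreteMap E g) ≫ f) k = evalSimplex f (g.app m k) :=
  (Category.assoc _ _ _).symm.trans (congrArg (· ≫ f.app m) (simplexι_tensorMapRight T g k))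

end Discrete

/-! ### Fibrations as maps with natural boundary fillers -/

section Fillers

variable {E : Type u} [Category.{v} E] {X Y : SimplicialObject E}

/-- A lifting problem against `p` with shape `Z × ∂Δ[n] ⟶ Z × Δ[n]`, in terms of generalized
elements. -/
structure BoundaryProblem (p : X ⟶ Y) (n : ℕ) (Z : E) where
  /-- the boundary in `X` -/
  bd {m : SimplexCategory} (α : m ⟶ ⦋n⦌) (hα : ¬ Function.Surjective α.toOrderHom) :
    Z ⟶ X.obj (op m)
  bd_comp {m m' : SimplexCategory} (γ : m' ⟶ m) (α : m ⟶ ⦋n⦌)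
    (hα : ¬ Function.Surjective α.toOrderHom)
    (h : ¬ Function.Surjective (SimplexCategory.Hom.toOrderHom (γ ≫ α))) :
    bd (γ ≫ α) h = bd α hα ≫ X.map γ.op
  /-- the simplex of `Y` -/
  base : Z ⟶ Y.obj (op ⦋n⦌)
  bd_base {m : SimplexCategory} (α : m ⟶ ⦋n⦌) (hα : ¬ Function.Surjective α.toOrderHom) :
    bd α hα ≫ p.app (op m) = base ≫ Y.map α.op

/-- Restriction of a lifting problem along a map of parameter objects. -/
def BoundaryProblem.restrict {p : X ⟶ Y} {n : ℕ} {Z Z' : E} (b : BoundaryProblem p n Z)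
    (t : Z' ⟶ Z) : BoundaryProblem p n Z' where
  bd α hα := t ≫ b.bd α hα
  bd_comp γ α hα h := by rw [b.bd_comp γ α hα h, Category.assoc]
  base := t ≫ b.base
  bd_base α hα := by rw [Category.assoc, b.bd_base, Category.assoc]

/-- A natural choice of solutions of lifting problems against `∂Δ[n] ⟶ Δ[n]`. -/
structure Filler (p : X ⟶ Y) (n : ℕ) where
  /-- the chosen solution -/
  fill {Z : E} (b : BoundaryProblem p n Z) : Z ⟶ X.obj (op ⦋n⦌)
  fill_map {Z : E} (b : BoundaryProblem p n Z) {m : SimplexCategory} (α : m ⟶ ⦋n⦌)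
    (hα : ¬ Function.Surjective α.toOrderHom) : fill b ≫ X.map α.op = b.bd α hα
  fill_base {Z : E} (b : BoundaryProblem p n Z) : fill b ≫ p.app (op ⦋n⦌) = b.base
  fill_restrict {Z Z' : E} (b : BoundaryProblem p n Z) (t : Z' ⟶ Z) :
    fill (b.restrict t) = t ≫ fill b

variable [CountablyLextensive E] {p : X ⟶ Y} {n : ℕ}

/-- A boundary problem over Z is an element at Z of the presheaf of lifting problems. The filler is
the value of the chosen lift at the top simplex of Δ[n], and naturality of the section gives
stability under restriction. -/
lemma nonempty_filler_of_hasEnrichedLiftingProperty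
    (h : HasEnrichedLiftingProperty (discreteMap E (SSet.boundary.{0} n).ι) p) :
    Nonempty (Filler p n) := by
  obtain ⟨⟨s, hs⟩⟩ := h.exists_splitEpi
  have hbd {Z : E} (b : BoundaryProblem p n Z) := exists_evalSimplex_eq (E := E) (T := Z)
    (K := (SSet.boundary.{0} n : SSet)) (X := X) (fun m k ↦ b.bd (SSet.stdSimplex.objEquiv k.1) k.2)
    (fun m m' α k ↦ b.bd_comp α.unop _ _ _)
  have hst {Z : E} (b : BoundaryProblem p n Z) := exists_evalSimplex_eq (E := E) (T := Z)
    (K := Δ[n]) (X := Y) (fun m k ↦ b.base ≫ Y.map (SSet.stdSimplex.objEquiv k).op)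
    (fun m m' α k ↦ by
      rw [SSet.stdSimplex.map_apply, Equiv.apply_symm_apply, op_comp, Y.map_comp,
        Category.assoc, Quiver.Hom.op_unop])
  choose f hf using @hbd
  choose g hg using @hst
  let w {Z : E} (b : BoundaryProblem p n Z) :
      (probPsh (discreteMap E (SSet.boundary.{0} n).ι) p).obj (op Z) :=
    ⟨(f b, g b), evalSimplex_ext fun m k ↦ by
      rw [evalSimplex_comp, evalSimplex_tensorMapRight, hf, hg]
      exact b.bd_base (m := m.unop) _ _⟩
  let d {Z : E} (b : BoundaryProblem p n Z) : tensor Z (discreteObj E Δ[n]) ⟶ X :=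
    s.app (op Z) (w b)
  have hd {Z : E} (b : BoundaryProblem p n Z) :
      (pullbackHom (discreteMap E (SSet.boundary.{0} n).ι) p).app (op Z) (d b) = w b :=
    ConcreteCategory.congr_hom (NatTrans.congr_app hs (op Z)) (w b)
  have hd₁ {Z : E} (b : BoundaryProblem p n Z) :
      tensorMapRight Z (discreteMap E (SSet.boundary.{0} n).ι) ≫ d b = f b :=
    congrArg (fun x ↦ x.1.1) (hd b)
  have hd₂ {Z : E} (b : BoundaryProblem p n Z) : d b ≫ p = g b :=
    congrArg (fun x ↦ x.1.2) (hd b)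
  have hw {Z Z' : E} (b : BoundaryProblem p n Z) (t : Z' ⟶ Z) :
      w (b.restrict t) = (probPsh _ p).map t.op (w b) := by
    refine Subtype.ext (Prod.ext (evalSimplex_ext fun m k ↦ ?_) (evalSimplex_ext fun m k ↦ ?_))
    · refine (hf _ m k).trans (Eq.trans ?_ (evalSimplex_tensorMapLeft t (f b) k).symm)
      rw [hf]
      rfl
    · refine (hg _ m k).trans (Eq.trans ?_ (evalSimplex_tensorMapLeft t (g b) k).symm)
      rw [hg, ← Category.assoc]
      rfl
  let e : (Δ[n] : SSet.{0}).obj (op ⦋n⦌) := SSet.stdSimplex.objEquiv.symm (𝟙 ⦋n⦌)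
  have he {m : SimplexCategory} (α : m ⟶ ⦋n⦌) :
      (Δ[n] : SSet.{0}).map α.op e = SSet.stdSimplex.objEquiv.symm α := by
    simp [e, SSet.stdSimplex.map_apply]
  refine ⟨⟨fun b ↦ evalSimplex (d b) e, fun b m α hα ↦ ?_, fun b ↦ ?_, fun {Z Z'} b t ↦ ?_⟩⟩
  · rw [← evalSimplex_map, he]
    let k : (SSet.boundary.{0} n : SSet).obj (op m) := ⟨SSet.stdSimplex.objEquiv.symm α, hα⟩
    have := hf b (op m) k
    rw [← hd₁, evalSimplex_tensorMapRight] at this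
    exact this
  · rw [← evalSimplex_comp, hd₂, hg]
    simp [e]
  · have : d (b.restrict t) = tensorMapLeft t _ ≫ d b := by
      dsimp only [d]
      rw [hw]
      exact ConcreteCategory.congr_hom (s.naturality t.op) (w b)
    rw [this, evalSimplex_tensorMapLeft]

/-- By the Yoneda lemma a filler extends to a map Z × Δ[n] ⟶ X; `fill_restrict` makes the resulting
section natural in Z. -/
lemma Filler.hasEnrichedLiftingProperty (F : Filler p n) :
    HasEnrichedLiftingProperty (discreteMap E (SSet.boundary.{0} n).ι) p := by
  let e : (Δ[n] : SSet.{0}).obj (op ⦋n⦌) := SSet.stdSimplex.objEquiv.symm (𝟙 ⦋n⦌)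
  have he {m : SimplexCategory} (α : m ⟶ ⦋n⦌) :
      (Δ[n] : SSet.{0}).map α.op e = SSet.stdSimplex.objEquiv.symm α := by
    simp [e, SSet.stdSimplex.map_apply]
  have hw {Z : E} (w : (probPsh (discreteMap E (SSet.boundary.{0} n).ι) p).obj (op Z))
      {m : SimplexCategoryᵒᵖ} (k : (SSet.boundary.{0} n : SSet).obj m) :
      evalSimplex w.1.1 k ≫ p.app m = evalSimplex w.1.2 k.1 := by
    rw [← evalSimplex_comp, w.2, evalSimplex_tensorMapRight]
    rfl
  let b {Z : E} (w : (probPsh (discreteMap E (SSet.boundary.{0} n).ι) p).obj (op Z)) :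
      BoundaryProblem p n Z :=
    { bd {m} α hα := evalSimplex (K := (SSet.boundary.{0} n : SSet)) w.1.1 (m := op m)
        ⟨SSet.stdSimplex.objEquiv.symm α, hα⟩
      bd_comp γ α hα h :=
        evalSimplex_map (K := (SSet.boundary.{0} n : SSet)) w.1.1 γ.op
          ⟨SSet.stdSimplex.objEquiv.symm α, hα⟩
      base := evalSimplex w.1.2 e
      bd_base α hα := (hw w _).trans (by rw [← evalSimplex_map, he]) }
  have hd {Z : E} (b : BoundaryProblem p n Z) := exists_evalSimplex_eq (E := E) (T := Z)
    (K := Δ[n]) (X := X) (fun m k ↦ F.fill b ≫ X.map (SSet.stdSimplex.objEquiv k).op)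
    (fun m m' α k ↦ by
      rw [SSet.stdSimplex.map_apply, Equiv.apply_symm_apply, op_comp, X.map_comp,
        Category.assoc, Quiver.Hom.op_unop])
  choose d hd using @hd
  refine ⟨⟨⟨⟨fun T ↦ ↾fun w ↦ d (b w), fun T T' t ↦ ?_⟩, ?_⟩⟩⟩
  · ext w
    refine evalSimplex_ext fun m k ↦ (hd _ m k).trans
      (Eq.trans ?_ (evalSimplex_tensorMapLeft t.unop (d (b w)) k).symm)
    rw [hd, ← Category.assoc, ← F.fill_restrict]
    congr 2
    dsimp only [b, BoundaryProblem.restrict]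
    congr 1
    · funext m α hα
      exact evalSimplex_tensorMapLeft _ _ _
    · exact evalSimplex_tensorMapLeft _ _ _
  · ext T w
    refine Subtype.ext (Prod.ext (evalSimplex_ext fun m k ↦ ?_) (evalSimplex_ext fun m k ↦ ?_))
    · refine (evalSimplex_tensorMapRight (SSet.boundary.{0} n).ι (d (b w)) k).trans ?_
      rw [hd]
      exact F.fill_map (b w) (SSet.stdSimplex.objEquiv k.1) k.2
    · refine (evalSimplex_comp (d (b w)) p k).trans ?_
      rw [hd, Category.assoc, p.naturality, ← Category.assoc, F.fill_base]
      dsimp only [b]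
      rw [← evalSimplex_map, he]
      rfl

lemma isEnrichedFibration_boundaryInclusions_iff :
    IsEnrichedFibration (boundaryInclusions E) p ↔ ∀ n, Nonempty (Filler p n) := by
  refine ⟨fun h n ↦ nonempty_filler_of_hasEnrichedLiftingProperty
    (h _ (.mk n)), fun h A B i hi ↦ ?_⟩
  obtain ⟨n⟩ := hi
  exact (h n).some.hasEnrichedLiftingProperty

end Fillers

end EffectiveModel

end
noncomputable section

namespace EffectiveModel

/-! ### Factorisations and degeneracies in the simplex category -/

section SimplexCategory

lemma exists_isSplitEpi_factorisation {m : SimplexCategory} {l : ℕ} (e : m ⟶ ⦋l⦌) :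
    ∃ (k : ℕ) (_ : k ≤ l) (e' : m ⟶ ⦋k⦌) (μ : ⦋k⦌ ⟶ ⦋l⦌) (ν : ⦋k⦌ ⟶ m),
      ν ≫ e' = 𝟙 _ ∧ e' ≫ μ = e := by
  have := isSplitEpi_of_epi (factorThruImage e)
  exact ⟨(image e).len, SimplexCategory.len_le_of_mono (image.ι e), factorThruImage e, image.ι e,
    section_ (factorThruImage e), IsSplitEpi.id _, image.fac e⟩

lemma exists_mono_factorisation {m : SimplexCategory} {n : ℕ} (α : m ⟶ ⦋n⦌)
    (hα : ¬ Function.Surjective α.toOrderHom) :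
    ∃ (l : ℕ) (_ : l < n) (e : m ⟶ ⦋l⦌) (δ : ⦋l⦌ ⟶ ⦋n⦌), Mono δ ∧ e ≫ δ = α := by
  cases n with
  | zero => exact (hα fun x ↦ ⟨0, Subsingleton.elim (α := Fin 1) _ _⟩).elim
  | succ n =>
    obtain ⟨i, θ, rfl⟩ := SimplexCategory.eq_comp_δ_of_not_surjective α hα
    exact ⟨n, n.lt_succ_self, θ, SimplexCategory.δ i, inferInstance, rfl⟩

lemma not_surjective_of_lt {m n : ℕ} (h : m < n) (α : ⦋m⦌ ⟶ ⦋n⦌) :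
    ¬ Function.Surjective α.toOrderHom := fun hα ↦ by
  have := SimplexCategory.epi_iff_surjective.2 hα
  exact absurd (SimplexCategory.len_le_of_epi α) (by simpa using h)

lemma not_injective_of_lt {m n : ℕ} (h : m < n) (α : ⦋n⦌ ⟶ ⦋m⦌) :
    ¬ Function.Injective α.toOrderHom := fun hα ↦ by
  have := SimplexCategory.mono_iff_injective.2 hα
  exact absurd (SimplexCategory.len_le_of_mono α) (by simpa using h)

/-- The simplicial identities move σ i to the front. This is what compares values on simplices that
are degenerate in two ways. -/
lemma σ_comp_δ_comp_σ {n : ℕ} {i j : Fin (n + 1)} (h : i ≤ j) :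
    ∃ r : ⦋n⦌ ⟶ ⦋n⦌, SimplexCategory.σ j ≫ SimplexCategory.δ j.succ ≫ SimplexCategory.σ i =
      SimplexCategory.σ i ≫ r := by
  obtain rfl | h := h.eq_or_lt
  · exact ⟨𝟙 _, by rw [SimplexCategory.δ_comp_σ_succ]⟩
  · cases n with
    | zero => omega
    | succ n =>
      obtain ⟨i', rfl⟩ := Fin.eq_castSucc_of_ne_last (Fin.ne_last_of_lt h)
      obtain ⟨j', rfl⟩ := Fin.eq_succ_of_ne_zero (Fin.ne_zero_of_lt h)
      refine ⟨SimplexCategory.σ j' ≫ SimplexCategory.δ j'.succ, ?_⟩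
      rw [SimplexCategory.δ_comp_σ_of_gt h, SimplexCategory.σ_comp_σ_assoc
        (Fin.castSucc_lt_succ_iff.1 h)]

/-- The elementary degeneracies of domain `⦋n⦌`, with the properties that make it possible to
glue along them. -/
lemma exists_degeneracies (n : ℕ) :
    ∃ (ι : Type) (_ : Fintype ι) (k : ι → ℕ) (_ : ∀ j, k j < n) (σ : ∀ j, ⦋n⦌ ⟶ ⦋k j⦌)
      (δ : ∀ j, ⦋k j⦌ ⟶ ⦋n⦌), (∀ j, δ j ≫ σ j = 𝟙 _) ∧
      (∀ (l : ℕ) (α : ⦋n⦌ ⟶ ⦋l⦌), ¬ Function.Injective α.toOrderHom →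
        ∃ (j : ι) (β : ⦋k j⦌ ⟶ ⦋l⦌), α = σ j ≫ β) ∧
      ∀ j j', (∃ r, σ j' ≫ δ j' ≫ σ j = σ j ≫ r) ∨ ∃ r, σ j ≫ δ j ≫ σ j' = σ j' ≫ r := by
  cases n with
  | zero =>
    exact ⟨Empty, inferInstance, Empty.elim, fun j ↦ j.elim, fun j ↦ j.elim, fun j ↦ j.elim,
      fun j ↦ j.elim, fun l α hα ↦ (hα fun x y _ ↦ Subsingleton.elim (α := Fin 1) _ _).elim,
      fun j ↦ j.elim⟩
  | succ n =>
    refine ⟨Fin (n + 1), inferInstance, fun _ ↦ n, fun _ ↦ n.lt_succ_self,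
      fun j ↦ SimplexCategory.σ j, fun j ↦ SimplexCategory.δ j.succ,
      fun j ↦ SimplexCategory.δ_comp_σ_succ,
      fun l α hα ↦ SimplexCategory.eq_σ_comp_of_not_injective α hα, fun i j ↦ ?_⟩
    exact (le_total i j).imp σ_comp_δ_comp_σ σ_comp_δ_comp_σ

end SimplexCategory

/-! ### Generalized elements of T × X -/

section Tensor

variable {E : Type u} [Category.{v} E] [HasFiniteLimits E]

/-- The generalized element `(t, x)` of `(T × X)_n`. -/
def tensorLift {Z T : E} {X : SimplicialObject E} {n : SimplexCategoryᵒᵖ} (t : Z ⟶ T)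
    (x : Z ⟶ X.obj n) : Z ⟶ (tensor T X).obj n :=
  prod.lift t x

/-- The first projection `(T × X)_n ⟶ T`. -/
def tensorFst (T : E) (X : SimplicialObject E) (n : SimplexCategoryᵒᵖ) :
    (tensor T X).obj n ⟶ T :=
  prod.fst

/-- The second projection `(T × X)_n ⟶ X_n`. -/
def tensorSnd (T : E) (X : SimplicialObject E) (n : SimplexCategoryᵒᵖ) :
    (tensor T X).obj n ⟶ X.obj n :=
  prod.snd

variable {T T' : E} {X Y : SimplicialObject E} {n n' : SimplexCategoryᵒᵖ}

lemma tensorLift_fst_snd : tensorLift (tensorFst T X n) (tensorSnd T X n) = 𝟙 _ :=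
  prod.lift_fst_snd

lemma comp_tensorLift {Z Z' : E} (s : Z' ⟶ Z) (t : Z ⟶ T) (x : Z ⟶ X.obj n) :
    s ≫ tensorLift t x = tensorLift (s ≫ t) (s ≫ x) :=
  prod.comp_lift _ _ _

lemma tensorLift_tensorSnd {Z : E} (t : Z ⟶ T) (x : Z ⟶ X.obj n) :
    tensorLift t x ≫ tensorSnd T X n = x :=
  prod.lift_snd _ _

lemma tensorLift_map {Z : E} (t : Z ⟶ T) (x : Z ⟶ X.obj n) (α : n ⟶ n') :
    tensorLift t x ≫ (tensor T X).map α = tensorLift t (x ≫ X.map α) :=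
  (prod.lift_map _ _ _ _).trans (congrArg (prod.lift · _) (Category.comp_id t))

lemma tensorLift_tensorMapLeft {Z : E} (t : Z ⟶ T) (x : Z ⟶ X.obj n) (s : T ⟶ T') :
    tensorLift t x ≫ (tensorMapLeft s X).app n = tensorLift (t ≫ s) x :=
  (prod.lift_map _ _ _ _).trans (congrArg (prod.lift _ ·) (Category.comp_id x))

lemma tensorLift_tensorMapRight {Z : E} (t : Z ⟶ T) (x : Z ⟶ X.obj n) (f : X ⟶ Y) :
    tensorLift t x ≫ (tensorMapRight T f).app n = tensorLift t (x ≫ f.app n) :=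
  (prod.lift_map _ _ _ _).trans (congrArg (prod.lift · _) (Category.comp_id t))

lemma map_tensorFst (α : n ⟶ n') :
    (tensor T X).map α ≫ tensorFst T X n' = tensorFst T X n :=
  (prod.map_fst _ _).trans (Category.comp_id _)

lemma map_tensorSnd (α : n ⟶ n') :
    (tensor T X).map α ≫ tensorSnd T X n' = tensorSnd T X n ≫ X.map α :=
  prod.map_snd _ _

lemma tensorMapLeft_tensorFst (s : T ⟶ T') :
    (tensorMapLeft s X).app n ≫ tensorFst T' X n = tensorFst T X n ≫ s :=
  prod.map_fst _ _

lemma tensorMapLeft_tensorSnd (s : T ⟶ T') :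
    (tensorMapLeft s X).app n ≫ tensorSnd T' X n = tensorSnd T X n :=
  (prod.map_snd _ _).trans (Category.comp_id _)

lemma tensorMapRight_tensorFst (f : X ⟶ Y) :
    (tensorMapRight T f).app n ≫ tensorFst T Y n = tensorFst T X n :=
  (prod.map_fst _ _).trans (Category.comp_id _)

lemma tensorMapRight_tensorSnd (f : X ⟶ Y) :
    (tensorMapRight T f).app n ≫ tensorSnd T Y n = tensorSnd T X n ≫ f.app n :=
  prod.map_snd _ _

end Tensor

/-! ### The universal lifting problem -/

section Problems

variable {E : Type u} [Category.{v} E] [HasFiniteLimits E] {A B X Y : SimplicialObject E}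
  (i : A ⟶ B) (p : X ⟶ Y)

/-- The universal lifting problem: its top map. -/
def probTop (n : SimplexCategoryᵒᵖ) : NatFamily (probPsh i p) (A.obj n) (X.obj n) where
  app {Z} w a := tensorLift (𝟙 Z) a ≫ w.1.1.app n
  naturality {Z' Z} t w a := by
    change tensorLift (𝟙 Z') (t ≫ a) ≫ (tensorMapLeft t A).app n ≫ w.1.1.app n = _
    rw [← Category.assoc, tensorLift_tensorMapLeft, ← Category.assoc, comp_tensorLift,
      Category.id_comp, Category.comp_id]

/-- The universal lifting problem: its bottom map. -/
def probBot (n : SimplexCategoryᵒᵖ) : NatFamily (probPsh i p) (B.obj n) (Y.obj n) where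
  app {Z} w b := tensorLift (𝟙 Z) b ≫ w.1.2.app n
  naturality {Z' Z} t w b := by
    change tensorLift (𝟙 Z') (t ≫ b) ≫ (tensorMapLeft t B).app n ≫ w.1.2.app n = _
    rw [← Category.assoc, tensorLift_tensorMapLeft, ← Category.assoc, comp_tensorLift,
      Category.id_comp, Category.comp_id]

variable {i p} {Z : E} (w : (probPsh i p).obj (op Z)) {n n' : SimplexCategoryᵒᵖ}

lemma probTop_map (a : Z ⟶ A.obj n) (α : n ⟶ n') :
    (probTop i p n').app w (a ≫ A.map α) = (probTop i p n).app w a ≫ X.map α := by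
  change tensorLift _ _ ≫ _ = (tensorLift _ _ ≫ _) ≫ _
  rw [← tensorLift_map, Category.assoc, w.1.1.naturality, Category.assoc]

lemma probBot_map (b : Z ⟶ B.obj n) (α : n ⟶ n') :
    (probBot i p n').app w (b ≫ B.map α) = (probBot i p n).app w b ≫ Y.map α := by
  change tensorLift _ _ ≫ _ = (tensorLift _ _ ≫ _) ≫ _
  rw [← tensorLift_map, Category.assoc, w.1.2.naturality, Category.assoc]

lemma probTop_comp (a : Z ⟶ A.obj n) :
    (probTop i p n).app w a ≫ p.app n = (probBot i p n).app w (a ≫ i.app n) := by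
  change (tensorLift _ _ ≫ _) ≫ _ = tensorLift _ _ ≫ _
  rw [← tensorLift_tensorMapRight, Category.assoc, Category.assoc, ← NatTrans.comp_app,
    ← NatTrans.comp_app, w.2]

/-- A solution of the universal lifting problem gives the enriched lifting property. -/
lemma hasEnrichedLiftingProperty_of_natFamily
    (L : ∀ n : SimplexCategoryᵒᵖ, NatFamily (probPsh i p) (B.obj n) (X.obj n))
    (hmap : ∀ ⦃n n' : SimplexCategoryᵒᵖ⦄ (α : n ⟶ n') ⦃Z : E⦄ (w : (probPsh i p).obj (op Z))
      (b : Z ⟶ B.obj n), (L n').app w (b ≫ B.map α) = (L n).app w b ≫ X.map α)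
    (htop : ∀ (n : SimplexCategoryᵒᵖ) ⦃Z : E⦄ (w : (probPsh i p).obj (op Z)) (a : Z ⟶ A.obj n),
      (L n).app w (a ≫ i.app n) = (probTop i p n).app w a)
    (hbot : ∀ (n : SimplexCategoryᵒᵖ) ⦃Z : E⦄ (w : (probPsh i p).obj (op Z)) (b : Z ⟶ B.obj n),
      (L n).app w b ≫ p.app n = (probBot i p n).app w b) :
    HasEnrichedLiftingProperty i p := by
  -- In degree n the lift is the family evaluated at the generic element, the pair of projections at
  -- stage (T × B)_n.
  let d {T : E} (w : (probPsh i p).obj (op T)) : tensor T B ⟶ X :=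
    { app n := (L n).app ((probPsh i p).map (tensorFst T B n).op w) (tensorSnd T B n)
      naturality n n' α := by
        rw [← (L n').naturality, map_tensorSnd, hmap, ← ConcreteCategory.comp_apply,
          ← Functor.map_comp, ← op_comp, map_tensorFst] }
  refine ⟨⟨⟨⟨fun T ↦ ↾fun w ↦ d w, fun T T' t ↦ ?_⟩, ?_⟩⟩⟩
  · ext w
    refine NatTrans.ext (funext fun n ↦ ?_)
    change (L n).app ((probPsh i p).map (tensorFst T'.unop B n).op ((probPsh i p).map t w))
      (tensorSnd T'.unop B n) = (tensorMapLeft t.unop B).app n ≫ (L n).app _ _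
    rw [← (L n).naturality, tensorMapLeft_tensorSnd, ← ConcreteCategory.comp_apply,
      ← ConcreteCategory.comp_apply, ← Functor.map_comp, ← Functor.map_comp, ← op_comp,
      tensorMapLeft_tensorFst]
    rfl
  · ext ⟨T⟩ w
    refine Subtype.ext (Prod.ext (NatTrans.ext (funext fun n ↦ ?_))
      (NatTrans.ext (funext fun n ↦ ?_)))
    · change (tensorMapRight T i).app n ≫ (L n).app _ _ = w.1.1.app n
      rw [← (L n).naturality, tensorMapRight_tensorSnd, htop, ← ConcreteCategory.comp_apply,
        ← Functor.map_comp, ← op_comp, tensorMapRight_tensorFst]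
      change tensorLift _ _ ≫ (tensorMapLeft (tensorFst T A n) A).app n ≫ w.1.1.app n = _
      rw [← Category.assoc, tensorLift_tensorMapLeft, Category.id_comp, tensorLift_fst_snd,
        Category.id_comp]
    · change (L n).app _ _ ≫ p.app n = w.1.2.app n
      rw [hbot]
      change tensorLift _ _ ≫ (tensorMapLeft (tensorFst T B n) B).app n ≫ w.1.2.app n = _
      rw [← Category.assoc, tensorLift_tensorMapLeft, Category.id_comp, tensorLift_fst_snd,
        Category.id_comp]

end Problems

end EffectiveModel

end
noncomputable section

namespace EffectiveModel

/-- Construction of a sequence by recursion, each term being related to all earlier ones. -/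
lemma exists_seq_of_forall_lt {C : ℕ → Type*} (R : ∀ k l, C k → C l → Prop)
    (h : ∀ (n : ℕ) (L : ∀ k, k < n → C k),
      (∀ k l (hk : k < n) (hl : l < n), k ≤ l → R k l (L k hk) (L l hl)) →
      ∃ c : C n, R n n c c ∧ ∀ k (hk : k < n), R k n (L k hk) c) :
    ∃ L : ∀ k, C k, ∀ k l, k ≤ l → R k l (L k) (L l) := by
  let S (n : ℕ) := {L : ∀ k, k < n → C k //
    ∀ k l (hk : k < n) (hl : l < n), k ≤ l → R k l (L k hk) (L l hl)}
  have step (n : ℕ) (L : S n) : ∃ L' : S (n + 1), ∀ k (hk : k < n),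
      L'.1 k (hk.trans n.lt_succ_self) = L.1 k hk := by
    obtain ⟨c, hc, hcL⟩ := h n L.1 L.2
    refine ⟨⟨fun k hk ↦ if hk' : k < n then L.1 k hk' else
      (Nat.eq_of_lt_succ_of_not_lt hk hk') ▸ c, fun k l hk hl hkl ↦ ?_⟩, fun k hk ↦ dif_pos hk⟩
    dsimp only
    rcases Nat.lt_succ_iff_lt_or_eq.1 hl with hl' | rfl
    · rw [dif_pos hl', dif_pos (hkl.trans_lt hl')]
      exact L.2 k l _ _ hkl
    · rw [dif_neg (lt_irrefl l)]
      rcases hkl.lt_or_eq with hk' | rfl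
      · rw [dif_pos hk']
        exact hcL k hk'
      · rw [dif_neg (lt_irrefl k)]
        exact hc
  choose next hnext using step
  let F (n : ℕ) : S n := Nat.rec ⟨fun k hk ↦ (Nat.not_lt_zero k hk).elim,
    fun k l hk ↦ (Nat.not_lt_zero k hk).elim⟩ next n
  -- Each stage extends the previous one, so the k-th term can be read off at any later stage.
  have hF (n k : ℕ) (hk : k < n) : (F n).1 k hk = (F (k + 1)).1 k k.lt_succ_self := by
    induction n with
    | zero => exact (Nat.not_lt_zero k hk).elim
    | succ n ih =>
      rcases Nat.lt_succ_iff_lt_or_eq.1 hk with hk' | rfl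
      · exact (hnext n (F n) k hk').trans (ih hk')
      · rfl
  refine ⟨fun k ↦ (F (k + 1)).1 k k.lt_succ_self, fun k l hkl ↦ ?_⟩
  dsimp only
  rw [← hF (l + 1) k (Nat.lt_succ_of_le hkl)]
  exact (F (l + 1)).2 k l _ _ hkl

/-! ### Extending a partial lift by filling boundaries -/

section Extension

variable {E : Type u} [Category.{v} E] [HasFiniteLimits E] {A B X Y : SimplicialObject E}
  {i : A ⟶ B} {p : X ⟶ Y}

/-- A family in degree `n` solving the universal lifting problem in that degree. -/
structure IsLiftAt {n : ℕ} (L : NatFamily (probPsh i p) (B.obj (op ⦋n⦌)) (X.obj (op ⦋n⦌))) :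
    Prop where
  top ⦃Z : E⦄ (w : (probPsh i p).obj (op Z)) (a : Z ⟶ A.obj (op ⦋n⦌)) :
    L.app w (a ≫ i.app _) = (probTop i p _).app w a
  bot ⦃Z : E⦄ (w : (probPsh i p).obj (op Z)) (b : Z ⟶ B.obj (op ⦋n⦌)) :
    L.app w b ≫ p.app _ = (probBot i p _).app w b

/-- Compatibility of families in degrees `k` and `l` with the operators `⦋k⦌ ⟶ ⦋l⦌`. -/
def AreCompatible {k l : ℕ} (L : NatFamily (probPsh i p) (B.obj (op ⦋k⦌)) (X.obj (op ⦋k⦌)))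
    (M : NatFamily (probPsh i p) (B.obj (op ⦋l⦌)) (X.obj (op ⦋l⦌))) : Prop :=
  ∀ (α : ⦋k⦌ ⟶ ⦋l⦌) ⦃Z : E⦄ (w : (probPsh i p).obj (op Z)) (b : Z ⟶ B.obj (op ⦋l⦌)),
    L.app w (b ≫ B.map α.op) = M.app w b ≫ X.map α.op

variable {n : ℕ}
  {L : ∀ k, k < n → NatFamily (probPsh i p) (B.obj (op ⦋k⦌)) (X.obj (op ⦋k⦌))}

/-- Families in degrees `< n` have a common value on each proper face of an `n`-simplex. -/
lemma exists_boundary_value (hL : ∀ k l (hk : k < n) (hl : l < n), AreCompatible (L k hk) (L l hl))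
    {Z : E} (w : (probPsh i p).obj (op Z)) (b : Z ⟶ B.obj (op ⦋n⦌)) {m : SimplexCategory}
    (α : m ⟶ ⦋n⦌) (hα : ¬ Function.Surjective α.toOrderHom) :
    ∃ x : Z ⟶ X.obj (op m), ∀ (l : ℕ) (hl : l < n) (e : m ⟶ ⦋l⦌) (δ : ⦋l⦌ ⟶ ⦋n⦌), e ≫ δ = α →
      x = (L l hl).app w (b ≫ B.map δ.op) ≫ X.map e.op := by
  obtain ⟨l₀, hl₀, e₀, δ₀, _, h₀⟩ := exists_mono_factorisation α hα
  refine ⟨(L l₀ hl₀).app w (b ≫ B.map δ₀.op) ≫ X.map e₀.op, fun l hl e δ h ↦ ?_⟩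
  -- Because δ₀ is monic, e₀ factors through the split epimorphism e' onto the image of e.
  -- Compatibility along ν ≫ e₀ and along μ then expresses both candidate values through the same
  -- value in degree k.
  obtain ⟨k, hk, e', μ, ν, hν, he⟩ := exists_isSplitEpi_factorisation e
  have h₁ : e₀ = e' ≫ ν ≫ e₀ := by
    rw [← cancel_mono δ₀, Category.assoc, Category.assoc, h₀, ← h, ← he, Category.assoc,
      reassoc_of% hν]
  have h₂ : (ν ≫ e₀) ≫ δ₀ = μ ≫ δ := by
    rw [Category.assoc, h₀, ← h, ← he, Category.assoc, reassoc_of% hν]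
  have h₃ := hL k l₀ (hk.trans_lt hl) hl₀ (ν ≫ e₀) w (b ≫ B.map δ₀.op)
  have h₄ := hL k l (hk.trans_lt hl) hl μ w (b ≫ B.map δ.op)
  rw [Category.assoc, ← B.map_comp, ← op_comp] at h₃ h₄
  rw [h₂, h₄] at h₃
  rw [h₁, op_comp, X.map_comp, ← Category.assoc, ← h₃, Category.assoc, ← X.map_comp, ← op_comp, he]

/-- The family obtained from families in degrees `< n` by filling boundaries. -/
lemma exists_fill_family (F : Filler p n) (hlift : ∀ k (hk : k < n), IsLiftAt (L k hk))
    (hL : ∀ k l (hk : k < n) (hl : l < n), AreCompatible (L k hk) (L l hl)) :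
    ∃ G : NatFamily (probPsh i p) (B.obj (op ⦋n⦌)) (X.obj (op ⦋n⦌)),
      (∀ ⦃Z : E⦄ (w : (probPsh i p).obj (op Z)) (b : Z ⟶ B.obj (op ⦋n⦌)),
        G.app w b ≫ p.app _ = (probBot i p _).app w b) ∧
      ∀ k (hk : k < n), AreCompatible (L k hk) G := by
  choose bd hbd using
    fun (Z : E) (w : (probPsh i p).obj (op Z)) (b : Z ⟶ B.obj (op ⦋n⦌)) (m : SimplexCategory)
      (α : m ⟶ ⦋n⦌) (hα) ↦ exists_boundary_value hL w b α hα
  let P {Z : E} (w : (probPsh i p).obj (op Z)) (b : Z ⟶ B.obj (op ⦋n⦌)) :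
      BoundaryProblem p n Z :=
    { bd {m} α hα := bd Z w b m α hα
      bd_comp γ α hα h := by
        obtain ⟨l, hl, e, δ, _, rfl⟩ := exists_mono_factorisation α hα
        rw [hbd _ _ _ _ _ _ l hl e δ rfl, hbd _ _ _ _ _ _ l hl (γ ≫ e) δ (Category.assoc _ _ _),
          op_comp, X.map_comp, Category.assoc]
      base := (probBot i p _).app w b
      bd_base α hα := by
        obtain ⟨l, hl, e, δ, _, rfl⟩ := exists_mono_factorisation α hα
        rw [hbd _ _ _ _ _ _ l hl e δ rfl, Category.assoc, p.naturality, ← Category.assoc,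
          (hlift l hl).bot, probBot_map, op_comp, Y.map_comp, Category.assoc] }
  -- Although chosen, the boundary values are computed by any factorisation, so the problem is
  -- natural in Z.
  have hP {Z Z' : E} (t : Z' ⟶ Z) (w : (probPsh i p).obj (op Z)) (b : Z ⟶ B.obj (op ⦋n⦌)) :
      P ((probPsh i p).map t.op w) (t ≫ b) = (P w b).restrict t := by
    dsimp only [P, BoundaryProblem.restrict]
    congr 1
    · funext m α hα
      obtain ⟨l, hl, e, δ, _, rfl⟩ := exists_mono_factorisation α hα
      rw [hbd _ _ _ _ _ _ l hl e δ rfl, hbd _ _ _ _ _ _ l hl e δ rfl, Category.assoc,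
        (L l hl).naturality, Category.assoc]
    · exact (probBot i p _).naturality t w b
  refine ⟨⟨fun w b ↦ F.fill (P w b), fun t w b ↦ ?_⟩, fun Z w b ↦ F.fill_base _,
    fun k hk α Z w b ↦ ?_⟩
  · rw [hP, F.fill_restrict]
  · refine Eq.trans ?_ (F.fill_map (P w b) α (not_surjective_of_lt hk α)).symm
    refine Eq.trans ?_ (hbd _ _ _ _ _ _ k hk (𝟙 _) α (Category.id_comp _)).symm
    rw [op_id, X.map_id, Category.comp_id]

end Extension

/-! ### Sufficiency of the complementedness conditions -/

section Characterisation

variable {E : Type u} [Category.{v} E] [CountablyLextensive E] {A B X Y : SimplicialObject E}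
  {i : A ⟶ B} {p : X ⟶ Y}

/-- The complement of `A_n` is carried by degeneracies to complemented subobjects of `B_m`. -/
lemma isComplementedInclusion_complement_map {m n : SimplexCategory} {s : m ⟶ n}
    (hs : IsRelativelyComplementedAt i s) {C : E} {c : C ⟶ B.obj (op n)}
    (hc : IsCoprod (i.app (op n)) c) : IsComplementedInclusion (c ≫ B.map s.op) := by
  obtain ⟨_, h⟩ := hs
  -- C is the complement of A_m in the pushout, and the pushout is complemented in B_m.
  have h₁ := (hc.of_isPushout (IsPushout.of_hasPushout (A.map s.op) (i.app (op n)))).symm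
  have h₂ := (isComplementedInclusion_iff.2 ⟨_, _, h₁⟩).comp h
  rwa [Category.assoc, pushout.inr_desc] at h₂

/-- The inductive step: the boundary-filling family is corrected on A_n and on the degenerate
complements. The prescribed values already lie over Y and have the right faces, so the correction
keeps both properties. Non-injective operators factor through an elementary degeneracy, hence no
further compatibility has to be imposed. -/
lemma exists_extension (hi : IsLevelwiseComplementedInclusion i)
    (hs : ∀ ⦃m n : SimplexCategory⦄ (s : m ⟶ n), Function.Surjective s.toOrderHom →
      IsRelativelyComplementedAt i s)
    {n : ℕ} (F : Filler p n)
    (L : ∀ k, k < n → NatFamily (probPsh i p) (B.obj (op ⦋k⦌)) (X.obj (op ⦋k⦌)))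
    (hlift : ∀ k (hk : k < n), IsLiftAt (L k hk))
    (hL : ∀ k l (hk : k < n) (hl : l < n), AreCompatible (L k hk) (L l hl)) :
    ∃ H : NatFamily (probPsh i p) (B.obj (op ⦋n⦌)) (X.obj (op ⦋n⦌)), IsLiftAt H ∧
      AreCompatible H H ∧
        ∀ k (hk : k < n), AreCompatible (L k hk) H ∧ AreCompatible H (L k hk) := by
  obtain ⟨G, hGbot, hG⟩ := exists_fill_family F hlift hL
  obtain ⟨ι, _, k, hk, σ, δ, hδσ, hfac, hcomb⟩ := exists_degeneracies n
  choose C c hc using fun m ↦ isComplementedInclusion_iff.1 (hi m)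
  have hmono (m : SimplexCategory) : Mono (i.app (op m)) := (hi m).mono
  have hσ (j : ι) : Function.Surjective (σ j).toOrderHom := by
    have : IsSplitEpi (σ j) := ⟨⟨⟨δ j, hδσ j⟩⟩⟩
    exact SimplexCategory.epi_iff_surjective.1 inferInstance
  have hB (j : ι) : B.map (σ j).op ≫ B.map (δ j).op = 𝟙 _ := by
    rw [← B.map_comp, ← op_comp, hδσ, op_id, B.map_id]
  -- the pieces: `A_n` and, for each elementary degeneracy, the complement of `A_{n-1}`
  let U : Option ι → E := fun o ↦ o.elim (A.obj (op ⦋n⦌)) fun j ↦ C ⦋k j⦌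
  let u : ∀ o, U o ⟶ B.obj (op ⦋n⦌) := fun o ↦ match o with
    | none => i.app _
    | some j => c _ ≫ B.map (σ j).op
  have hu : ∀ o, IsComplementedInclusion (u o) := fun o ↦ match o with
    | none => hi _
    | some j => isComplementedInclusion_complement_map (hs _ (hσ j)) (hc _)
  let f : ∀ o, NatFamily (probPsh i p) (U o) (X.obj (op ⦋n⦌)) := fun o ↦ match o with
    | none => probTop i p _
    | some j => ((L (k j) (hk j)).precomp (c _)).postcomp (X.map (σ j).op)
  have htop (j : ι) {Z : E} (w : (probPsh i p).obj (op Z)) (x : Z ⟶ A.obj (op ⦋n⦌))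
      (y : Z ⟶ B.obj (op ⦋k j⦌)) (h : x ≫ i.app _ = y ≫ B.map (σ j).op) :
      (probTop i p _).app w x = (L (k j) (hk j)).app w y ≫ X.map (σ j).op := by
    -- If an element of A_n becomes degenerate in B_n, the section δ j shows that y comes from A; as
    -- i is monic, x is already degenerate in A.
    have hy : y = (x ≫ A.map (δ j).op) ≫ i.app _ := by
      rw [Category.assoc, i.naturality, reassoc_of% h, hB, Category.comp_id]
    have hx : (x ≫ A.map (δ j).op) ≫ A.map (σ j).op = x := by
      rw [← cancel_mono (i.app (op ⦋n⦌)), Category.assoc, i.naturality, ← Category.assoc, ← hy, h]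
    rw [hy, (hlift _ _).top, ← probTop_map, hx]
  have hdeg (j j' : ι) (hjj' : ∃ r, σ j' ≫ δ j' ≫ σ j = σ j ≫ r) {Z : E}
      (w : (probPsh i p).obj (op Z)) (x : Z ⟶ B.obj (op ⦋k j⦌)) (y : Z ⟶ B.obj (op ⦋k j'⦌))
      (h : x ≫ B.map (σ j).op = y ≫ B.map (σ j').op) :
      (L (k j) (hk j)).app w x ≫ X.map (σ j).op =
        (L (k j') (hk j')).app w y ≫ X.map (σ j').op := by
    obtain ⟨r, hr⟩ := hjj'
    -- The sections recover y from x and show that x is fixed by the endomorphism r. Compatibility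
    -- along r then fixes the value at x too, and σ j' ≫ δ j' ≫ σ j = σ j ≫ r identifies the two
    -- degenerate values.
    have hy : y = x ≫ B.map (δ j' ≫ σ j).op := by
      rw [op_comp, B.map_comp, reassoc_of% h, hB, Category.comp_id]
    have hr' : r = δ j ≫ σ j' ≫ δ j' ≫ σ j := by
      rw [hr, reassoc_of% hδσ j]
    have hx : x = x ≫ B.map r.op := by
      rw [hr']
      simp only [op_comp, B.map_comp, Category.assoc]
      rw [reassoc_of% h, reassoc_of% hB j', ← reassoc_of% h, hB, Category.comp_id]
    have h₁ := hL _ _ (hk j) (hk j) r w x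
    rw [← hx] at h₁
    rw [hy, hL _ _ (hk j') (hk j) (δ j' ≫ σ j) w x, Category.assoc, ← X.map_comp, ← op_comp, hr,
      op_comp, X.map_comp, ← Category.assoc, ← h₁]
  obtain ⟨H, hHu, hH⟩ := G.exists_glue Finset.univ U u hu f (by
    rintro (_ | j) (_ | j') Z w x y h
    · rw [(cancel_mono (i.app (op ⦋n⦌))).1 h]
    · exact htop j' w x (y ≫ c _) (h.trans (Category.assoc _ _ _).symm)
    · exact (htop j w y (x ≫ c _) (h.symm.trans (Category.assoc _ _ _).symm)).symm
    · have h' : (x ≫ c _) ≫ B.map (σ j).op = (y ≫ c _) ≫ B.map (σ j').op :=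
        (Category.assoc _ _ _).trans (h.trans (Category.assoc _ _ _).symm)
      rcases hcomb j j' with hr | hr
      · exact hdeg j j' hr w _ _ h'
      · exact (hdeg j' j hr w _ _ h'.symm).symm)
  have hHtop ⦃Z : E⦄ (w : (probPsh i p).obj (op Z)) (a : Z ⟶ A.obj (op ⦋n⦌)) :
      H.app w (a ≫ i.app _) = (probTop i p _).app w a := hHu none (Finset.mem_univ _) w a
  have hHσ (j : ι) ⦃Z : E⦄ (w : (probPsh i p).obj (op Z)) (b : Z ⟶ B.obj (op ⦋k j⦌)) :
      H.app w (b ≫ B.map (σ j).op) = (L (k j) (hk j)).app w b ≫ X.map (σ j).op := by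
    -- Prescribing H on the degenerate complement suffices: degeneracies of elements of A lie in
    -- A_n, where H is the given top map.
    refine NatFamily.app_eq_of_isCoprod (hc ⦋k j⦌) (H.precomp (B.map (σ j).op))
      ((L (k j) (hk j)).postcomp (X.map (σ j).op)) (fun Z w x ↦ ?_) (fun Z w x ↦ ?_) w b
    · change H.app w ((x ≫ _) ≫ _) = (L (k j) (hk j)).app w _ ≫ _
      rw [(hlift _ _).top, Category.assoc, ← i.naturality, ← Category.assoc, hHtop, probTop_map]
    · change H.app w ((x ≫ _) ≫ _) = _
      rw [Category.assoc]
      exact hHu (some j) (Finset.mem_univ _) w x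
  have hHface (l : ℕ) (hl : l < n) : AreCompatible (L l hl) H := by
    intro α Z w b
    refine (hH (X.map α.op) ((L l hl).precomp (B.map α.op)) (fun Z w b ↦ (hG l hl α w b).symm)
      ?_ w b).symm
    rintro (_ | j) Z w x
    · change Z ⟶ A.obj (op ⦋n⦌) at x
      change (probTop i p _).app w x ≫ _ = (L l hl).app w ((x ≫ i.app _) ≫ _)
      rw [Category.assoc, ← i.naturality, ← Category.assoc, (hlift _ _).top, probTop_map]
    · change Z ⟶ C ⦋k j⦌ at x
      change ((L (k j) (hk j)).app w (x ≫ _) ≫ _) ≫ _ = (L l hl).app w ((x ≫ c _ ≫ _) ≫ _)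
      rw [Category.assoc, ← X.map_comp, ← op_comp, ← hL l (k j) hl (hk j), op_comp, B.map_comp]
      simp only [Category.assoc]
  refine ⟨H, ⟨hHtop, hH (p.app _) (probBot i p _) hGbot ?_⟩, fun α Z w b ↦ ?_,
    fun l hl ↦ ⟨hHface l hl, fun α Z w b ↦ ?_⟩⟩
  · rintro (_ | j) Z w x
    · exact probTop_comp w x
    · change Z ⟶ C ⦋k j⦌ at x
      change ((L (k j) (hk j)).app w (x ≫ _) ≫ _) ≫ _ = (probBot i p _).app w (x ≫ c _ ≫ _)
      rw [Category.assoc, p.naturality, ← Category.assoc, (hlift _ _).bot, ← probBot_map,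
        Category.assoc]
  -- An endomorphism of ⦋n⦌ is the identity or factors through an elementary degeneracy.
  · by_cases hα : Function.Injective α.toOrderHom
    · have := SimplexCategory.mono_iff_injective.2 hα
      rw [SimplexCategory.eq_id_of_mono α, op_id, B.map_id, X.map_id, Category.comp_id,
        Category.comp_id]
    · obtain ⟨j, β, rfl⟩ := hfac n α hα
      rw [op_comp, B.map_comp, ← Category.assoc, hHσ, hHface, X.map_comp, Category.assoc]
  · obtain ⟨j, β, rfl⟩ := hfac l α (not_injective_of_lt hl α)
    rw [op_comp, B.map_comp, ← Category.assoc, hHσ, hL (k j) l (hk j) hl, X.map_comp,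
      Category.assoc]

/-- The sufficient condition for a map to be a cofibration. -/
lemma isCofibration_of_isRelativelyComplementedAt (hi : IsLevelwiseComplementedInclusion i)
    (hs : ∀ ⦃m n : SimplexCategory⦄ (s : m ⟶ n), Function.Surjective s.toOrderHom →
      IsRelativelyComplementedAt i s) : IsCofibration i := by
  intro X Y p hp
  have F (n : ℕ) := ((isEnrichedFibration_boundaryInclusions_iff.1 hp) n).some
  obtain ⟨L, hL⟩ := exists_seq_of_forall_lt
    (C := fun k ↦ {L : NatFamily (probPsh i p) (B.obj (op ⦋k⦌)) (X.obj (op ⦋k⦌)) // IsLiftAt L})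
    (fun k l L M ↦ AreCompatible L.1 M.1 ∧ AreCompatible M.1 L.1) (fun n L hL ↦ by
      obtain ⟨H, hH, hHH, hHL⟩ := exists_extension hi hs (F n) (fun k hk ↦ (L k hk).1)
        (fun k hk ↦ (L k hk).2) (fun k l hk hl ↦ (le_total k l).elim
          (fun h ↦ (hL k l hk hl h).1) (fun h ↦ (hL l k hl hk h).2))
      exact ⟨⟨H, hH⟩, ⟨hHH, hHH⟩, hHL⟩)
  refine hasEnrichedLiftingProperty_of_natFamily (fun n ↦ (L n.unop.len).1)
    (fun n n' α Z w b ↦ ?_) (fun n ↦ (L n.unop.len).2.top) (fun n ↦ (L n.unop.len).2.bot)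
  exact (le_total n.unop.len n'.unop.len).elim (fun h ↦ (hL _ _ h).2 α.unop w b)
    (fun h ↦ (hL _ _ h).1 α.unop w b)

end Characterisation

end EffectiveModel

end
noncomputable section

namespace EffectiveModel

/-! ### From enriched to ordinary lifting -/

section OrdinaryLifting

variable {E : Type u} [Category.{v} E] [HasFiniteLimits E]

/-- The enriched lifting property implies the ordinary one. -/
lemma HasEnrichedLiftingProperty.exists_lift {A B X Y : SimplicialObject E} {i : A ⟶ B}
    {p : X ⟶ Y} (h : HasEnrichedLiftingProperty i p) (f : A ⟶ X) (g : B ⟶ Y)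
    (sq : f ≫ p = i ≫ g) : ∃ d : B ⟶ X, i ≫ d = f ∧ d ≫ p = g := by
  obtain ⟨⟨s, hs⟩⟩ := h.exists_splitEpi
  -- The enriched lift is taken at stage 1 and transported along the projection 1 × X ⟶ X and its
  -- section.
  let pr (X : SimplicialObject E) : tensor (⊤_ E) X ⟶ X :=
    ⟨fun n ↦ tensorSnd _ X n, fun n n' α ↦ map_tensorSnd α⟩
  have hpr {X Y : SimplicialObject E} (f : X ⟶ Y) :
      tensorMapRight (⊤_ E) f ≫ pr Y = pr X ≫ f :=
    NatTrans.ext (funext fun n ↦ tensorMapRight_tensorSnd f)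
  let sec (X : SimplicialObject E) : X ⟶ tensor (⊤_ E) X :=
    ⟨fun n ↦ tensorLift (terminal.from _) (𝟙 _), fun n n' α ↦ by
      rw [comp_tensorLift, tensorLift_map, Category.comp_id, Category.id_comp]
      congr 1
      exact Subsingleton.elim _ _⟩
  have hsec {X Y : SimplicialObject E} (f : X ⟶ Y) :
      sec X ≫ tensorMapRight (⊤_ E) f = f ≫ sec Y := by
    refine NatTrans.ext (funext fun n ↦ ?_)
    change tensorLift _ _ ≫ _ = f.app n ≫ tensorLift _ _
    rw [comp_tensorLift, tensorLift_tensorMapRight, Category.comp_id, Category.id_comp]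
    congr 1
    exact Subsingleton.elim _ _
  have hsp (X : SimplicialObject E) : sec X ≫ pr X = 𝟙 X :=
    NatTrans.ext (funext fun n ↦ tensorLift_tensorSnd _ _)
  let w : (probPsh i p).obj (op (⊤_ E)) := ⟨(pr A ≫ f, pr B ≫ g), by
    change (pr A ≫ f) ≫ p = tensorMapRight (⊤_ E) i ≫ pr B ≫ g
    rw [← Category.assoc, hpr, Category.assoc, sq, Category.assoc]⟩
  let d : tensor (⊤_ E) B ⟶ X := s.app (op (⊤_ E)) w
  have hd : (pullbackHom i p).app (op (⊤_ E)) d = w :=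
    ConcreteCategory.congr_hom (NatTrans.congr_app hs (op (⊤_ E))) w
  have hd₁ : tensorMapRight (⊤_ E) i ≫ d = pr A ≫ f := congrArg (fun x ↦ x.1.1) hd
  have hd₂ : d ≫ p = pr B ≫ g := congrArg (fun x ↦ x.1.2) hd
  refine ⟨sec B ≫ d, ?_, ?_⟩
  · rw [← Category.assoc, ← hsec, Category.assoc, hd₁, ← Category.assoc, hsp, Category.id_comp]
  · rw [Category.assoc, hd₂, ← Category.assoc, hsp, Category.id_comp]

end OrdinaryLifting

/-! ### Simplicial objects coinduced from arrows -/

section Coinduced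

variable {E : Type u} [Category.{v} E] [HasFiniteLimits E]
  {m n : SimplexCategory} (s : m ⟶ n) {N M N' M' : E} (f' : N' ⟶ M') (f : N ⟶ M)

/-- The object of pairs of families `g` of elements of `N` indexed by the maps `n ⟶ k` and `h` of
elements of `M` indexed by the maps `m ⟶ k`, such that `f (g x) = h (s ≫ x)`. -/
abbrev coindObj (k : SimplexCategory) : E :=
  pullback (Limits.Pi.map fun _ : n ⟶ k ↦ f)
    (Pi.lift fun x : n ⟶ k ↦ Pi.π (fun _ : m ⟶ k ↦ M) (s ≫ x))

/-- The projection to the component of `N` indexed by `x`. -/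
def coindFst {k : SimplexCategory} (x : n ⟶ k) : coindObj s f k ⟶ N :=
  pullback.fst _ _ ≫ Pi.π (fun _ : n ⟶ k ↦ N) x

/-- The projection to the component of `M` indexed by `y`. -/
def coindSnd {k : SimplexCategory} (y : m ⟶ k) : coindObj s f k ⟶ M :=
  pullback.snd _ _ ≫ Pi.π (fun _ : m ⟶ k ↦ M) y

lemma coindFst_comp {k : SimplexCategory} (x : n ⟶ k) :
    coindFst s f x ≫ f = coindSnd s f (s ≫ x) := by
  have h := pullback.condition (f := Limits.Pi.map fun _ : n ⟶ k ↦ f)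
    (g := Pi.lift fun x : n ⟶ k ↦ Pi.π (fun _ : m ⟶ k ↦ M) (s ≫ x)) =≫ Pi.π _ x
  rw [Category.assoc, Category.assoc, Pi.lift_π, Limits.Pi.map_π] at h
  rw [coindFst, Category.assoc, h]
  rfl

variable {s f f'}

lemma coindObj_hom_ext {k : SimplexCategory} {Z : E} {a b : Z ⟶ coindObj s f k}
    (h₁ : ∀ x, a ≫ coindFst s f x = b ≫ coindFst s f x)
    (h₂ : ∀ y, a ≫ coindSnd s f y = b ≫ coindSnd s f y) : a = b := by
  apply pullback.hom_ext
  · refine Pi.hom_ext _ _ fun x ↦ ?_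
    rw [Category.assoc, Category.assoc]
    exact h₁ x
  · refine Pi.hom_ext _ _ fun y ↦ ?_
    rw [Category.assoc, Category.assoc]
    exact h₂ y

/-- Generalized elements of `coindObj s f k`. -/
def coindLift {k : SimplexCategory} {Z : E} (g : (n ⟶ k) → (Z ⟶ N)) (h : (m ⟶ k) → (Z ⟶ M))
    (hgh : ∀ x, g x ≫ f = h (s ≫ x)) : Z ⟶ coindObj s f k :=
  pullback.lift (Pi.lift g) (Pi.lift h) (by
    refine Pi.hom_ext _ _ fun x ↦ ?_
    rw [Category.assoc, Category.assoc, Limits.Pi.map_π, Pi.lift_π, Pi.lift_π, ← Category.assoc,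
      Pi.lift_π, hgh])

lemma coindLift_fst {k : SimplexCategory} {Z : E} (g : (n ⟶ k) → (Z ⟶ N))
    (h : (m ⟶ k) → (Z ⟶ M)) (hgh : ∀ x, g x ≫ f = h (s ≫ x)) (x : n ⟶ k) :
    coindLift g h hgh ≫ coindFst s f x = g x := by
  rw [coindLift, coindFst, pullback.lift_fst_assoc, Pi.lift_π]

lemma coindLift_snd {k : SimplexCategory} {Z : E} (g : (n ⟶ k) → (Z ⟶ N))
    (h : (m ⟶ k) → (Z ⟶ M)) (hgh : ∀ x, g x ≫ f = h (s ≫ x)) (y : m ⟶ k) :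
    coindLift g h hgh ≫ coindSnd s f y = h y := by
  rw [coindLift, coindSnd, pullback.lift_snd_assoc, Pi.lift_π]

lemma coindFst_comp_map {k k' : SimplexCategory} (α : k' ⟶ k) (x : n ⟶ k') :
    coindFst s f (x ≫ α) ≫ f = coindSnd s f ((s ≫ x) ≫ α) := by
  rw [coindFst_comp, Category.assoc]

variable (s f) in
/-- The simplicial object coinduced from the arrow `f` along `s`: maps `B ⟶ coind s f` are
commutative squares from `B_n ⟶ B_m` to `f`. -/
def coind : SimplicialObject E where
  obj k := coindObj s f k.unop
  map α := coindLift (fun x ↦ coindFst s f (x ≫ α.unop)) (fun y ↦ coindSnd s f (y ≫ α.unop))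
    (coindFst_comp_map α.unop)
  map_id k := by
    refine coindObj_hom_ext (fun x ↦ ?_) (fun y ↦ ?_)
    · rw [coindLift_fst, unop_id, Category.comp_id, Category.id_comp]
    · rw [coindLift_snd, unop_id, Category.comp_id, Category.id_comp]
  map_comp α β := by
    refine coindObj_hom_ext (fun x ↦ ?_) (fun y ↦ ?_)
    · rw [coindLift_fst, Category.assoc, coindLift_fst, coindLift_fst, unop_comp, Category.assoc]
    · rw [coindLift_snd, Category.assoc, coindLift_snd, coindLift_snd, unop_comp, Category.assoc]

variable (s f) in
/-- `coindFst` as a map out of a degree of the simplicial object `coind s f`. -/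
def coindπ₁ {k : SimplexCategoryᵒᵖ} (x : n ⟶ k.unop) : (coind s f).obj k ⟶ N :=
  coindFst s f x

variable (s f) in
/-- `coindSnd` as a map out of a degree of the simplicial object `coind s f`. -/
def coindπ₂ {k : SimplexCategoryᵒᵖ} (y : m ⟶ k.unop) : (coind s f).obj k ⟶ M :=
  coindSnd s f y

lemma coindπ₁_comp {k : SimplexCategoryᵒᵖ} (x : n ⟶ k.unop) :
    coindπ₁ s f x ≫ f = coindπ₂ s f (s ≫ x) :=
  coindFst_comp s f x

lemma coind_map_π₁ {k k' : SimplexCategoryᵒᵖ} (α : k ⟶ k') (x : n ⟶ k'.unop) :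
    (coind s f).map α ≫ coindπ₁ s f x = coindπ₁ s f (x ≫ α.unop) :=
  coindLift_fst _ _ (coindFst_comp_map α.unop) _

lemma coind_map_π₂ {k k' : SimplexCategoryᵒᵖ} (α : k ⟶ k') (y : m ⟶ k'.unop) :
    (coind s f).map α ≫ coindπ₂ s f y = coindπ₂ s f (y ≫ α.unop) :=
  coindLift_snd _ _ (coindFst_comp_map α.unop) _

lemma coind_hom_ext {k : SimplexCategoryᵒᵖ} {Z : E} {a b : Z ⟶ (coind s f).obj k}
    (h₁ : ∀ x, a ≫ coindπ₁ s f x = b ≫ coindπ₁ s f x)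
    (h₂ : ∀ y, a ≫ coindπ₂ s f y = b ≫ coindπ₂ s f y) : a = b :=
  coindObj_hom_ext h₁ h₂

lemma exists_coind_lift {k : SimplexCategoryᵒᵖ} {Z : E} (g : (n ⟶ k.unop) → (Z ⟶ N))
    (h : (m ⟶ k.unop) → (Z ⟶ M)) (hgh : ∀ x, g x ≫ f = h (s ≫ x)) :
    ∃ a : Z ⟶ (coind s f).obj k, (∀ x, a ≫ coindπ₁ s f x = g x) ∧ ∀ y, a ≫ coindπ₂ s f y = h y :=
  ⟨coindLift g h hgh, coindLift_fst g h hgh, coindLift_snd g h hgh⟩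

lemma exists_coind_map (a : N ⟶ N') (b : M ⟶ M') (hab : a ≫ f' = f ≫ b) :
    ∃ p : coind s f ⟶ coind s f', (∀ k (x : n ⟶ k.unop),
      p.app k ≫ coindπ₁ s f' x = coindπ₁ s f x ≫ a) ∧
      ∀ k (y : m ⟶ k.unop), p.app k ≫ coindπ₂ s f' y = coindπ₂ s f y ≫ b := by
  choose p h₁ h₂ using fun k : SimplexCategoryᵒᵖ ↦ exists_coind_lift (s := s) (f := f') (k := k)
    (fun x ↦ coindπ₁ s f x ≫ a) (fun y ↦ coindπ₂ s f y ≫ b) (fun x ↦ by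
      rw [Category.assoc, hab, ← Category.assoc, coindπ₁_comp])
  refine ⟨⟨p, fun k k' α ↦ coind_hom_ext (fun x ↦ ?_) (fun y ↦ ?_)⟩, h₁, h₂⟩
  · rw [Category.assoc, Category.assoc, h₁, coind_map_π₁, h₁, ← Category.assoc, coind_map_π₁]
  · rw [Category.assoc, Category.assoc, h₂, coind_map_π₂, h₂, ← Category.assoc, coind_map_π₂]

/-- The existence half of the universal property of coinduction; the components at the identities
recover g and h. -/
lemma exists_to_coind {B : SimplicialObject E} (g : B.obj (op n) ⟶ N) (h : B.obj (op m) ⟶ M)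
    (hgh : g ≫ f = B.map s.op ≫ h) :
    ∃ a : B ⟶ coind s f, (∀ k (x : n ⟶ k.unop), a.app k ≫ coindπ₁ s f x = B.map x.op ≫ g) ∧
      ∀ k (y : m ⟶ k.unop), a.app k ≫ coindπ₂ s f y = B.map y.op ≫ h := by
  choose a h₁ h₂ using fun k : SimplexCategoryᵒᵖ ↦ exists_coind_lift (s := s) (f := f) (k := k)
    (fun x ↦ B.map x.op ≫ g) (fun y ↦ B.map y.op ≫ h) (fun x ↦ by
      rw [Category.assoc, hgh, op_comp, B.map_comp, Category.assoc])
  refine ⟨⟨a, fun k k' α ↦ coind_hom_ext (fun x ↦ ?_) (fun y ↦ ?_)⟩, h₁, h₂⟩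
  · rw [Category.assoc, Category.assoc, h₁, coind_map_π₁, h₁, op_comp, B.map_comp, Category.assoc]
    rfl
  · rw [Category.assoc, Category.assoc, h₂, coind_map_π₂, h₂, op_comp, B.map_comp, Category.assoc]
    rfl

/-- Maps of arrows with split epimorphic components coinduce maps with fillers. -/
lemma nonempty_filler_coind (hs : Function.Surjective s.toOrderHom) {a : N ⟶ N'} {b : M ⟶ M'}
    (hab : a ≫ f' = f ≫ b) (a' : N' ⟶ N) (ha : a' ≫ a = 𝟙 N') (b' : M' ⟶ M) (hb : b' ≫ b = 𝟙 M')
    {p : coind s f ⟶ coind s f'}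
    (hp₁ : ∀ k (x : n ⟶ k.unop), p.app k ≫ coindπ₁ s f' x = coindπ₁ s f x ≫ a)
    (hp₂ : ∀ k (y : m ⟶ k.unop), p.app k ≫ coindπ₂ s f' y = coindπ₂ s f y ≫ b) (k : ℕ) :
    Nonempty (Filler p k) := by
  -- Each y is s ≫ x for at most one x, so a value at y prescribed through x is unambiguous.
  have hepi : Epi s := SimplexCategory.epi_iff_surjective.2 hs
  have hsurj (x : n ⟶ ⦋k⦌) (hx : Function.Surjective x.toOrderHom) :
      Function.Surjective (SimplexCategory.Hom.toOrderHom (s ≫ x)) := hx.comp hs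
  have hcomp {l l' : SimplexCategory} (x : l' ⟶ l) (α : l ⟶ ⦋k⦌)
      (hα : ¬ Function.Surjective α.toOrderHom) :
      ¬ Function.Surjective (SimplexCategory.Hom.toOrderHom (x ≫ α)) :=
    fun h ↦ hα (Function.Surjective.of_comp h)
  -- the components on surjective maps are prescribed by the sections, the others by the boundary
  have key₁ (x : n ⟶ ⦋k⦌) : ∃ g : ∀ {Z : E}, BoundaryProblem p k Z → (Z ⟶ N),
      (Function.Surjective x.toOrderHom → ∀ {Z : E} (P : BoundaryProblem p k Z),
        g P = P.base ≫ coindπ₁ s f' x ≫ a') ∧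
      ∀ (hx : ¬ Function.Surjective x.toOrderHom) {Z : E} (P : BoundaryProblem p k Z),
        g P = P.bd x hx ≫ coindπ₁ s f (𝟙 n) := by
    by_cases hx : Function.Surjective x.toOrderHom
    · exact ⟨fun P ↦ P.base ≫ coindπ₁ s f' x ≫ a', fun _ _ _ ↦ rfl, fun h ↦ (h hx).elim⟩
    · exact ⟨fun P ↦ P.bd x hx ≫ coindπ₁ s f (𝟙 n), fun h ↦ (hx h).elim, fun _ _ _ ↦ rfl⟩
  choose g hg hg' using key₁
  -- For surjective y = s ≫ x the component is forced by the one at x. The section b' serves only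
  -- the surjective y not factoring through s, so a' and b' need not commute with f and f'.
  have key₂ (y : m ⟶ ⦋k⦌) : ∃ h : ∀ {Z : E}, BoundaryProblem p k Z → (Z ⟶ M),
      (∀ (hy : ¬ Function.Surjective y.toOrderHom) {Z : E} (P : BoundaryProblem p k Z),
        h P = P.bd y hy ≫ coindπ₂ s f (𝟙 m)) ∧
      (∀ x, s ≫ x = y → Function.Surjective x.toOrderHom → ∀ {Z : E} (P : BoundaryProblem p k Z),
        h P = g x P ≫ f) ∧
      (Function.Surjective y.toOrderHom → (∀ x, s ≫ x ≠ y) →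
        ∀ {Z : E} (P : BoundaryProblem p k Z), h P = P.base ≫ coindπ₂ s f' y ≫ b') := by
    by_cases hy : Function.Surjective y.toOrderHom
    · by_cases hex : ∃ x, s ≫ x = y
      · obtain ⟨x, rfl⟩ := hex
        refine ⟨fun P ↦ g x P ≫ f, fun h ↦ (h hy).elim, fun x' hx' _ Z P ↦ ?_,
          fun _ h ↦ (h x rfl).elim⟩
        rw [cancel_epi] at hx'
        rw [hx']
      · exact ⟨fun P ↦ P.base ≫ coindπ₂ s f' y ≫ b', fun h ↦ (h hy).elim,
          fun x hx ↦ (hex ⟨x, hx⟩).elim, fun _ _ _ _ ↦ rfl⟩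
    · exact ⟨fun P ↦ P.bd y hy ≫ coindπ₂ s f (𝟙 m), fun _ _ _ ↦ rfl,
        fun x hx hx' ↦ (hy (hx ▸ hsurj x hx')).elim, fun h ↦ (hy h).elim⟩
  choose h hh₁ hh₂ hh₃ using key₂
  have bdπ₁ {Z : E} (P : BoundaryProblem p k Z) {l : SimplexCategory} (α : l ⟶ ⦋k⦌)
      (hα : ¬ Function.Surjective α.toOrderHom) (x : n ⟶ l) :
      P.bd (x ≫ α) (hcomp x α hα) ≫ coindπ₁ s f (𝟙 n) = P.bd α hα ≫ coindπ₁ s f x := by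
    rw [P.bd_comp x α hα, Category.assoc, coind_map_π₁]
    simp
  have bdπ₂ {Z : E} (P : BoundaryProblem p k Z) {l : SimplexCategory} (α : l ⟶ ⦋k⦌)
      (hα : ¬ Function.Surjective α.toOrderHom) (y : m ⟶ l) :
      P.bd (y ≫ α) (hcomp y α hα) ≫ coindπ₂ s f (𝟙 m) = P.bd α hα ≫ coindπ₂ s f y := by
    rw [P.bd_comp y α hα, Category.assoc, coind_map_π₂]
    simp
  have hgh {Z : E} (P : BoundaryProblem p k Z) (x : n ⟶ ⦋k⦌) : g x P ≫ f = h (s ≫ x) P := by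
    by_cases hx : Function.Surjective x.toOrderHom
    · rw [hh₂ (s ≫ x) x rfl hx]
    · rw [hg' x hx, hh₁ (s ≫ x) (hcomp s x hx), bdπ₂, Category.assoc, coindπ₁_comp,
        Category.comp_id]
  have hga {Z : E} (P : BoundaryProblem p k Z) (x : n ⟶ ⦋k⦌) :
      g x P ≫ a = P.base ≫ coindπ₁ s f' x := by
    by_cases hx : Function.Surjective x.toOrderHom
    · rw [hg x hx, Category.assoc, Category.assoc, ha, Category.comp_id]
    · rw [hg' x hx, Category.assoc, ← hp₁, ← Category.assoc, P.bd_base, Category.assoc,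
        coind_map_π₁]
      simp
  choose F hF₁ hF₂ using fun (Z : E) (P : BoundaryProblem p k Z) ↦
    exists_coind_lift (s := s) (f := f) (k := op ⦋k⦌) (fun x ↦ g x P) (fun y ↦ h y P) (hgh P)
  refine ⟨⟨F _, fun {Z} P l α hα ↦ coind_hom_ext (fun x ↦ ?_) (fun y ↦ ?_),
    fun {Z} P ↦ coind_hom_ext (fun x ↦ ?_) (fun y ↦ ?_),
    fun {Z Z'} P t ↦ coind_hom_ext (fun x ↦ ?_) (fun y ↦ ?_)⟩⟩
  · rw [Category.assoc, coind_map_π₁, hF₁]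
    exact (hg' (x ≫ α) (hcomp x α hα) P).trans (bdπ₁ P α hα x)
  · rw [Category.assoc, coind_map_π₂, hF₂]
    exact (hh₁ (y ≫ α) (hcomp y α hα) P).trans (bdπ₂ P α hα y)
  · rw [Category.assoc, hp₁, ← Category.assoc, hF₁, hga]
  · rw [Category.assoc, hp₂, ← Category.assoc, hF₂]
    by_cases hy : Function.Surjective (SimplexCategory.Hom.toOrderHom y)
    · by_cases hex : ∃ x, s ≫ x = y
      · obtain ⟨x, rfl⟩ := hex
        rw [← hgh, Category.assoc, ← hab, ← Category.assoc, hga, Category.assoc, coindπ₁_comp]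
      · rw [hh₃ y hy fun x hx ↦ hex ⟨x, hx⟩, Category.assoc, Category.assoc, hb, Category.comp_id]
    · rw [hh₁ y hy, Category.assoc, ← hp₂, ← Category.assoc, P.bd_base, Category.assoc,
        coind_map_π₂]
      simp
  · rw [Category.assoc, hF₁, hF₁]
    by_cases hx : Function.Surjective (SimplexCategory.Hom.toOrderHom x)
    · rw [hg x hx, hg x hx]
      exact Category.assoc _ _ _
    · rw [hg' x hx, hg' x hx]
      exact Category.assoc _ _ _
  · rw [Category.assoc, hF₂, hF₂]
    by_cases hy : Function.Surjective (SimplexCategory.Hom.toOrderHom y)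
    · by_cases hex : ∃ x, s ≫ x = y
      · obtain ⟨x, rfl⟩ := hex
        rw [← hgh, ← hgh, ← Category.assoc]
        congr 1
        by_cases hx : Function.Surjective x.toOrderHom
        · rw [hg x hx, hg x hx]
          exact Category.assoc _ _ _
        · rw [hg' x hx, hg' x hx]
          exact Category.assoc _ _ _
      · have hex' : ∀ x, s ≫ x ≠ y := fun x hx ↦ hex ⟨x, hx⟩
        rw [hh₃ y hy hex', hh₃ y hy hex']
        exact Category.assoc _ _ _
    · rw [hh₁ y hy, hh₁ y hy]
      exact Category.assoc _ _ _

end Coinduced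

/-! ### Necessity of the complementedness conditions -/

section Necessity

variable {E : Type u} [Category.{v} E] [CountablyLextensive E] {A B : SimplicialObject E}
  {i : A ⟶ B}

/-- For a cofibration `A ⟶ B` and `s : m ⟶ n` surjective, the square from `A_n ⟶ A_m` to
`B_n ⟶ B_m` lifts against maps of arrows with split epimorphic components. -/
lemma IsCofibration.exists_lift (hi : IsCofibration i) {m n : SimplexCategory} {s : m ⟶ n}
    (hs : Function.Surjective s.toOrderHom) {N M N' M' : E} {f : N ⟶ M} {f' : N' ⟶ M'}
    {a : N ⟶ N'} {b : M ⟶ M'} (hab : a ≫ f' = f ≫ b) (a' : N' ⟶ N) (ha : a' ≫ a = 𝟙 N')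
    (b' : M' ⟶ M) (hb : b' ≫ b = 𝟙 M') (g : A.obj (op n) ⟶ N) (h : A.obj (op m) ⟶ M)
    (hgh : g ≫ f = A.map s.op ≫ h) (g' : B.obj (op n) ⟶ N') (h' : B.obj (op m) ⟶ M')
    (hgh' : g' ≫ f' = B.map s.op ≫ h') (hg : g ≫ a = i.app _ ≫ g') (hh : h ≫ b = i.app _ ≫ h') :
    ∃ (d : B.obj (op n) ⟶ N) (e : B.obj (op m) ⟶ M), d ≫ f = B.map s.op ≫ e ∧
      i.app _ ≫ d = g ∧ d ≫ a = g' ∧ i.app _ ≫ e = h ∧ e ≫ b = h' := by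
  obtain ⟨p, hp₁, hp₂⟩ := exists_coind_map (s := s) a b hab
  obtain ⟨t, ht₁, ht₂⟩ := exists_to_coind g h hgh
  obtain ⟨t', ht'₁, ht'₂⟩ := exists_to_coind g' h' hgh'
  have hfib : IsEnrichedFibration (boundaryInclusions E) p :=
    isEnrichedFibration_boundaryInclusions_iff.2 (nonempty_filler_coind hs hab a' ha b' hb hp₁ hp₂)
  obtain ⟨d, hd₁, hd₂⟩ := (hi p hfib).exists_lift t t' (by
    refine NatTrans.ext (funext fun k ↦ coind_hom_ext (fun x ↦ ?_) (fun y ↦ ?_))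
    · rw [NatTrans.comp_app, NatTrans.comp_app, Category.assoc, Category.assoc, hp₁, ht'₁,
        ← Category.assoc, ht₁, Category.assoc, hg, ← i.naturality_assoc]
    · rw [NatTrans.comp_app, NatTrans.comp_app, Category.assoc, Category.assoc, hp₂, ht'₂,
        ← Category.assoc, ht₂, Category.assoc, hh, ← i.naturality_assoc])
  refine ⟨d.app (op n) ≫ coindπ₁ s f (𝟙 n), d.app (op m) ≫ coindπ₂ s f (𝟙 m), ?_, ?_, ?_, ?_, ?_⟩
  · rw [Category.assoc, coindπ₁_comp, d.naturality_assoc, coind_map_π₂]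
    simp
  · rw [← Category.assoc, ← NatTrans.comp_app, hd₁, ht₁, op_id, A.map_id, Category.id_comp]
  · rw [Category.assoc, ← hp₁, ← Category.assoc, ← NatTrans.comp_app, hd₂, ht'₁, op_id, B.map_id,
      Category.id_comp]
  · rw [← Category.assoc, ← NatTrans.comp_app, hd₁, ht₂, op_id, A.map_id, Category.id_comp]
  · rw [Category.assoc, ← hp₂, ← Category.assoc, ← NatTrans.comp_app, hd₂, ht'₂, op_id, B.map_id,
      Category.id_comp]

/-- With s = 𝟙 and terminal second component in `f`, only degree n is tested: the lift is against
A_n ⨿ B_n ⟶ B_n, split by the second inclusion. -/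
lemma IsCofibration.isLevelwiseComplementedInclusion (hi : IsCofibration i) :
    IsLevelwiseComplementedInclusion i := by
  intro n
  obtain ⟨d, e, -, hd, hd', -, -⟩ := hi.exists_lift (s := 𝟙 n) Function.surjective_id
    (f := terminal.from (A.obj (op n) ⨿ B.obj (op n))) (f' := terminal.from (B.obj (op n)))
    (a := coprod.desc (i.app (op n)) (𝟙 _)) (b := 𝟙 _) (Subsingleton.elim _ _) coprod.inr
    (coprod.inr_desc _ _) (𝟙 _) (Category.comp_id _) coprod.inl (terminal.from _)
    (Subsingleton.elim _ _) (𝟙 _) (terminal.from _) (Subsingleton.elim _ _)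
    (by rw [coprod.inl_desc, Category.comp_id]) (Subsingleton.elim _ _)
  exact isComplementedInclusion_of_lift _ d hd hd'

/-- Taking a = 𝟙 on B_n forces d = 𝟙, so the square makes e agree with the first inclusion on both
parts of the pushout. The section `coprod.inr` of b need not respect the arrows, which is why
arbitrary componentwise sections are allowed. -/
lemma IsCofibration.isRelativelyComplementedAt (hi : IsCofibration i) {m n : SimplexCategory}
    (s : m ⟶ n) (hs : Function.Surjective s.toOrderHom) : IsRelativelyComplementedAt i s := by
  have hpush := (hi.isLevelwiseComplementedInclusion n).hasPushout (A.map s.op)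
  refine ⟨hpush, ?_⟩
  let q : pushout (A.map s.op) (i.app (op n)) ⟶ B.obj (op m) :=
    pushout.desc (i.app (op m)) (B.map s.op) (i.naturality s.op)
  obtain ⟨d, e, hde, -, hd, he, he'⟩ := hi.exists_lift hs (N := B.obj (op n)) (a := 𝟙 _)
    (f := pushout.inr (A.map s.op) (i.app (op n)) ≫ (coprod.inl : _ ⟶ _ ⨿ B.obj (op m)))
    (f' := B.map s.op) (b := coprod.desc q (𝟙 _))
    (by rw [Category.id_comp, Category.assoc, coprod.inl_desc, pushout.inr_desc])
    (𝟙 _) (Category.comp_id _) coprod.inr (coprod.inr_desc _ _) (i.app (op n))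
    (pushout.inl (A.map s.op) (i.app (op n)) ≫ coprod.inl) (by
      rw [← Category.assoc, ← Category.assoc, pushout.condition]) (𝟙 _) (𝟙 _)
    (by rw [Category.id_comp, Category.comp_id]) rfl
    (by rw [Category.assoc, coprod.inl_desc, pushout.inl_desc, Category.comp_id])
  rw [Category.comp_id] at hd
  rw [hd, Category.id_comp] at hde
  refine isComplementedInclusion_of_lift q e (pushout.hom_ext ?_ ?_) he'
  · rw [← Category.assoc, pushout.inl_desc, he]
  · rw [← Category.assoc, pushout.inr_desc, hde]

end Necessity

end EffectiveModel

end

/-- A map of simplicial objects in a countably lextensive category is a cofibration if and only if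
it is a levelwise complemented inclusion and, for each degeneracy operator `s : [m] ⟶ [n]`
(that is, each surjective monotone map), `A_m ⊔_{A_n} B_n ⟶ B_m` is a complemented inclusion. -/
theorem mainTheorem8 {E : Type u} [Category.{v} E] [EffectiveModel.CountablyLextensive E]
    {A B : SimplicialObject E} (i : A ⟶ B) :
    EffectiveModel.IsCofibration i ↔
      EffectiveModel.IsLevelwiseComplementedInclusion i ∧
        ∀ ⦃m n : SimplexCategory⦄ (s : m ⟶ n), Function.Surjective s.toOrderHom →
          EffectiveModel.IsRelativelyComplementedAt i s := by
  exact ⟨fun hi ↦ ⟨hi.isLevelwiseComplementedInclusion, fun _ _ s hs ↦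
    hi.isRelativelyComplementedAt s hs⟩, fun h ↦
    EffectiveModel.isCofibration_of_isRelativelyComplementedAt h.1 h.2⟩
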